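/- Let $\mathfrak{g}\subseteq\mathfrak{gl}(n)=\mathfrak{gl}(n,\mathbb{C})$ be the standard seaweed of type $\frac{a_1|\cdots|a_m}{b_1|\cdots|b_t}$, where $(a_1,\dots,a_m)$ and $(b_1,\dots,b_t)$ are compositions of $n$: the Lie algebra of all matrices preserving $V_i=\mathrm{span}\{e_1,\dots,e_{a_1+\cdots+a_i}\}$ for $0\le i\le m$ and $W_j=\mathrm{span}\{e_{b_1+\cdots+b_j+1},\dots,e_n\}$ for $0\le j\le t$. For a functional $f$ on a Lie algebra write $B_f(x,y)=f([x,y])$. *Meanders.* The meander of type $\frac{a_1|\cdots|a_m}{b_1|\cdots|b_t}$ has vertices $v_1,\dots,v_n$ on a line. They are divided from left to right into top blocks of sizes $a_1,\dots,a_m$ and into bottom blocks of sizes $b_1,\dots,b_t$. Within each top (bottom) block any two distinct vertices that are mirror images of each other in the block are joined by a top (bottom) edge. *Signature and homotopy type.* The meander is reduced to the empty meander by the following moves, exactly one of which applies at each step: - $C(c)$: if $a_1=b_1=c$, pass to $\frac{a_2|\cdots|a_m}{b_2|\cdots|b_t}$; - $F$: if $a_1<b_1$, pass to $\frac{b_1|\cdots|b_t}{a_1|\cdots|a_m}$;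 - $Bl$: if $a_1=2b_1$, pass to $\frac{b_1|a_2|\cdots|a_m}{b_2|\cdots|b_t}$; - $R$: if $b_1<a_1<2b_1$, pass to $\frac{b_1|a_2|\cdots|a_m}{(2b_1-a_1)|b_2|\cdots|b_t}$; - $P$: if $a_1>2b_1$, pass to $\frac{(a_1-2b_1)|b_1|a_2|\cdots|a_m}{b_2|\cdots|b_t}$. The sequence of moves is the signature. If $C(c_1),\dots,C(c_h)$ are the moves of the form $C(c)$ in it, in order, then $\mathfrak{g}$ has homotopy type $H(c_1,\dots,c_h)$. The component meander $CM(\mathfrak{g})$ is the meander whose signature arises from that of $\mathfrak{g}$ by replacing each $C(c_i)$ by $C(1)$. It is a disjoint union of $h$ paths, where the path of $c_i$ is the one that grows, when the moves are reversed, from the vertex created by the $i$-th of the moves $C(1)$. From left to right, the vertices of $CM(\mathfrak{g})$ stand for consecutive intervals $A$ that partition $\{1,\dots,n\}$, with $|A|=c_i$ if the vertex lies on the path of $c_i$; we write $v_A$ for the vertex. Orient the top edges of $CM(\mathfrak{g})$ from right to left and the bottom edges from left to right. Let $\mathfrak{P}_{c_i}$ be the set of all $A_I\times A_J$ such that $v_{A_I}\to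 v_{A_J}$ is an oriented edge on the path of $c_i$. Fix for each $i$ an arbitrary vertex on the path of $c_i$, and let $\mathscr{A}_{c_i}$ (respectively $\mathscr{B}_{c_i}$) be the set of those $A$ on that path for which $v_A$ has odd (respectively even) distance from it. *Functionals.* Let $e_{i,j}^*$ be the functional $X\mapsto X_{i,j}$. For $F=\sum\gamma_{p,q}e_{p,q}^*\in\mathfrak{gl}(c)^*$ let $F^{m}=\sum\gamma_{p,q}e_{p+m,q+m}^*$ for $m\in\mathbb{Z}_{\ge0}$, and $F^R=\sum\gamma_{p,q}e_{c+1-p,c+1-q}^*$. Given $F_{c_i}\in\mathfrak{gl}(c_i)^*$ for $1\le i\le h$, define $\overline{F}=\sum_{i=1}^h\overline{F}_{c_i}$ and $\overline{F}^a=\sum_{i=1}^h\overline{F}^a_{c_i}$ in $\mathfrak{g}^*$ by $$\overline{F}_{c_i}=\sum_{A\in\mathscr{A}_{c_i}\cup\mathscr{B}_{c_i}}(F_{c_i})^{\min A-1}+\sum_{A_I\times A_J\in\mathfrak{P}_{c_i}}\ \sum_{s=0}^{c_i-1}e^*_{\min A_I+s,\;\min A_J+s},$$ $$\overline{F}^a_{c_i}=\sum_{A\in\mathscr{A}_{c_i}}(F_{c_i}^R)^{\min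 A-1}+\sum_{A\in\mathscr{B}_{c_i}}(F_{c_i})^{\min A-1}+\sum_{A_I\times A_J\in\mathfrak{P}_{c_i}}\ \sum_{s=0}^{c_i-1}e^*_{\max A_I-s,\;\min A_J+s}.$$ **Theorem.** For arbitrary functionals $F_{c_i}\in\mathfrak{gl}(c_i)^*$, $1\le i\le h$, $$\dim\ker B_{\overline{F}^a}=\dim\ker B_{\overline{F}}=\sum_{i=1}^h\dim\ker B_{F_{c_i}}.$$ -/

import Mathlib

attribute [local instance 100] LieRing.ofAssociativeRing

noncomputable section

namespace Seaweed

/-! ## Seaweed subalgebras of `𝔤𝔩(n)` and Kirillov forms -/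

/-- The span of those standard basis vectors `e_k` of `ℂⁿ` whose (zero-based) index satisfies
`p`. -/
def coordSpan (n : ℕ) (p : ℕ → Prop) : Submodule ℂ (Fin n → ℂ) :=
  Submodule.span ℂ {v | ∃ k : Fin n, p k ∧ v = Pi.single k 1}

/-- `V_i = span {e_1, …, e_{a_1 + ⋯ + a_i}}`. -/
def flagV {n : ℕ} (a : Composition n) (i : ℕ) : Submodule ℂ (Fin n → ℂ) :=
  coordSpan n (fun k => k < a.sizeUpTo i)

/-- `W_j = span {e_{b_1 + ⋯ + b_j + 1}, …, e_n}`. -/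
def flagW {n : ℕ} (b : Composition n) (j : ℕ) : Submodule ℂ (Fin n → ℂ) :=
  coordSpan n (fun k => b.sizeUpTo j ≤ k)

/-- The standard seaweed of type `(a_1|⋯|a_m) / (b_1|⋯|b_t)`: the matrices that preserve all the
spaces `V_i` and `W_j`. -/
def seaweed {n : ℕ} (a b : Composition n) : LieSubalgebra ℂ (Matrix (Fin n) (Fin n) ℂ) where
  carrier := {X | (∀ i ≤ a.length, ∀ v ∈ flagV a i, X.mulVec v ∈ flagV a i) ∧
    (∀ j ≤ b.length, ∀ v ∈ flagW b j, X.mulVec v ∈ flagW b j)}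
  add_mem' := by
    rintro X Y ⟨hX, hX'⟩ ⟨hY, hY'⟩
    refine ⟨fun i hi v hv => ?_, fun i hi v hv => ?_⟩ <;> rw [Matrix.add_mulVec]
    · exact Submodule.add_mem _ (hX i hi v hv) (hY i hi v hv)
    · exact Submodule.add_mem _ (hX' i hi v hv) (hY' i hi v hv)
  zero_mem' := by
    refine ⟨fun i _ v _ => ?_, fun i _ v _ => ?_⟩ <;> rw [Matrix.zero_mulVec] <;>
      exact Submodule.zero_mem _
  smul_mem' := by
    rintro r X ⟨hX, hX'⟩
    refine ⟨fun i hi v hv => ?_, fun i hi v hv => ?_⟩ <;> rw [Matrix.smul_mulVec]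
    · exact Submodule.smul_mem _ _ (hX i hi v hv)
    · exact Submodule.smul_mem _ _ (hX' i hi v hv)
  lie_mem' := by
    rintro X Y ⟨hX, hX'⟩ ⟨hY, hY'⟩
    refine ⟨fun i hi v hv => ?_, fun i hi v hv => ?_⟩ <;>
      rw [Ring.lie_def, Matrix.sub_mulVec, ← Matrix.mulVec_mulVec, ← Matrix.mulVec_mulVec]
    · exact Submodule.sub_mem _ (hX i hi _ (hY i hi v hv)) (hY i hi _ (hX i hi v hv))
    · exact Submodule.sub_mem _ (hX' i hi _ (hY' i hi v hv)) (hY' i hi _ (hX' i hi v hv))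

/-- The Kirillov form `B_f(x, y) = f([x, y])` of a functional `f` on a Lie algebra. -/
def kirillovForm {L : Type*} [LieRing L] [LieAlgebra ℂ L] (f : Module.Dual ℂ L) :
    L →ₗ[ℂ] L →ₗ[ℂ] ℂ :=
  LinearMap.mk₂ ℂ (fun x y => f ⁅x, y⁆)
    (fun x x' y => by simp) (fun r x y => by simp) (fun x y y' => by simp) (fun r x y => by simp)

/-- `dim ker B_f`. -/
def dimKer {L : Type*} [LieRing L] [LieAlgebra ℂ L] (f : Module.Dual ℂ L) : ℕ :=
  Module.finrank ℂ (LinearMap.ker (kirillovForm f))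

/-! ## Winding down: signature and homotopy type -/

/-- The winding-down moves: block elimination, rotation contraction, pure contraction, flip, and
deletion of a component of size `c`. -/
inductive Move
  | Bl
  | R
  | P
  | F
  | C (c : ℕ)

/-- The signature of the meander of type `(a_1|⋯|a_m) / (b_1|⋯|b_t)`: the sequence of
winding-down moves that reduces it to the empty meander. (Only lists with positive entries and
equal sums are relevant; the two cases with value `[]` are reached for these at the empty meander
only.) -/
def signature : List ℕ → List ℕ → List Move
  | a :: as, b :: bs =>
    if a = 0 ∨ b = 0 then []
    else if a = b then Move.C a :: signature as bs
    else if a < b then Move.F :: signature (b :: bs) (a :: as)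
    else if a = 2 * b then Move.Bl :: signature (b :: as) bs
    else if a < 2 * b then Move.R :: signature (b :: as) ((2 * b - a) :: bs)
    else Move.P :: signature ((a - 2 * b) :: b :: as) bs
  | _, _ => []
termination_by as bs => 2 * (as.sum + bs.sum) + min 1 (bs.headD 0 - as.headD 0)
decreasing_by
  all_goals simp only [List.sum_cons, List.headD_cons]
  all_goals omega

/-- The list `c_1, …, c_h` of the sizes of the deleted components, in the order in which they
occur in a signature. -/
def deletions : List Move → List ℕ
  | [] => []
  | Move.C c :: S => c :: deletions S
  | _ :: S => deletions S

/-- The sizes `c_1, …, c_h` of the homotopy type `H(c_1, …, c_h)` of the seaweed of type `a / b`. -/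
def homotopyType {n : ℕ} (a b : Composition n) : List ℕ :=
  deletions (signature a.blocks b.blocks)

/-- The number `h` of components of the homotopy type. -/
def numComp {n : ℕ} (a b : Composition n) : ℕ := (homotopyType a b).length

/-- The size `c_i` of the `i`-th component of the homotopy type. -/
def compSize {n : ℕ} (a b : Composition n) (i : Fin (numComp a b)) : ℕ := (homotopyType a b).get i

/-! ## Meanders, winding up, and the component meander -/

/-- A meander, given by its top and bottom compositions, together with the list of its vertices
from left to right, where each vertex is recorded as the (zero-based) number of the component of
the homotopy type it belongs to. -/
structure LabelledMeander where
  top : List ℕ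
  bot : List ℕ
  label : List ℕ

/-- Winding up: the meander with a given signature, obtained from the empty meander by reversing
the moves, together with the component to which each vertex belongs.

* Reversing `C(c)` puts `c` new vertices, which form a new first component, on the left.
* Reversing `F` exchanges top and bottom.
* Reversing `Bl` gives `x|A / B ↦ 2x|A / x|B`. The old vertices are the last ones; the `i`-th of
  the `x` new vertices is joined by a top edge to the vertex in position `2x + 1 - i`.
* Reversing `R` gives `x|A / y|B ↦ (2x-y)|A / x|B`. The vertices after the new first bottom block
  are the old vertices after the first `y` ones, and the new first bottom block, of size `x`, is
  the mirror image of the old first top block; the `i`-th of the first `x - y` vertices is joined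
  by a top edge to the vertex in position `2x - y + 1 - i`.
* Reversing `P` gives `x|y|A / B ↦ (x+2y)|A / y|B`. The old vertices are the last ones; the `i`-th
  of the `y` new vertices is joined by a top edge to the vertex in position `x + 2y + 1 - i`. -/
def windUp : List Move → LabelledMeander
  | [] => ⟨[], [], []⟩
  | Move.C c :: S =>
    let M := windUp S
    ⟨c :: M.top, c :: M.bot, List.replicate c 0 ++ M.label.map Nat.succ⟩
  | Move.F :: S =>
    let M := windUp S
    ⟨M.bot, M.top, M.label⟩
  | Move.Bl :: S =>
    let M := windUp S
    match M.top with
    | x :: A => ⟨2 * x :: A, x :: M.bot, (M.label.take x).reverse ++ M.label⟩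
    | _ => M
  | Move.R :: S =>
    let M := windUp S
    match M.top, M.bot with
    | x :: A, y :: B =>
      ⟨(2 * x - y) :: A, x :: B, (M.label.take x).reverse ++ M.label.drop y⟩
    | _, _ => M
  | Move.P :: S =>
    let M := windUp S
    match M.top with
    | x :: y :: A =>
      ⟨(x + 2 * y) :: A, y :: M.bot, ((M.label.drop x).take y).reverse ++ M.label⟩
    | _ => M

/-- Replace all component deletions by deletions of components of size one. -/
def Move.toUnit : Move → Move
  | Move.C _ => Move.C 1
  | m => m

/-- The component meander `CM(𝔤)` of the seaweed of type `a / b`: the meander with the same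
signature, except that all component deletions have size one. -/
def compMeander {n : ℕ} (a b : Composition n) : LabelledMeander :=
  windUp ((signature a.blocks b.blocks).map Move.toUnit)

/-- The positions `u < v` of two vertices are joined by an arc of the meander edges for the given
blocks: for some block, `u` and `v` are mirror images of each other within that block. -/
def IsArc (blocks : List ℕ) (u v : ℕ) : Prop :=
  u < v ∧ ∃ k < blocks.length,
    (blocks.take k).sum ≤ u ∧ u + v + 1 = 2 * (blocks.take k).sum + blocks.getD k 0

instance (blocks : List ℕ) (u v : ℕ) : Decidable (IsArc blocks u v) := by
  unfold IsArc; infer_instance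

/-- The (zero-based) vertices of the component meander, from left to right. -/
abbrev CMVertex {n : ℕ} (a b : Composition n) : Type := Fin (compMeander a b).label.length

/-- `v` lies on the path of the component `c_i` in the component meander. -/
def OnPath {n : ℕ} (a b : Composition n) (i : Fin (numComp a b)) (v : CMVertex a b) : Prop :=
  (compMeander a b).label.get v = i

instance {n : ℕ} (a b : Composition n) (i : Fin (numComp a b)) (v : CMVertex a b) :
    Decidable (OnPath a b i v) := by
  unfold OnPath; infer_instance

/-- The edges of the component meander, oriented counter-clockwise: top edges from right to left,
bottom edges from left to right. -/
def OrientedEdge {n : ℕ} (a b : Composition n) (u v : CMVertex a b) : Prop :=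
  IsArc (compMeander a b).top v u ∨ IsArc (compMeander a b).bot u v

instance {n : ℕ} (a b : Composition n) (u v : CMVertex a b) :
    Decidable (OrientedEdge a b u v) := by
  unfold OrientedEdge; infer_instance

/-- The component meander as a graph. -/
def cmGraph {n : ℕ} (a b : Composition n) : SimpleGraph (CMVertex a b) :=
  SimpleGraph.fromRel (OrientedEdge a b)

/-- The vertex `v` of the component meander stands for a set `A` of consecutive indices, of the
size of the component to which `v` belongs; from left to right these sets partition all indices.
This is the zero-based index `min A`. -/
def minIdx {n : ℕ} (a b : Composition n) (v : CMVertex a b) : ℕ :=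
  (((compMeander a b).label.take v).map (fun i => (homotopyType a b).getD i 0)).sum

/-- The vertices on the path of `c_i` (each standing for a core block `A × A`). -/
def pathVertices {n : ℕ} (a b : Composition n) (i : Fin (numComp a b)) :
    Finset (CMVertex a b) :=
  Finset.univ.filter (fun v => OnPath a b i v)

/-- `𝒜_{c_i}`: the vertices on the path of `c_i` at odd distance from the chosen vertex `v₀`. -/
def oddVertices {n : ℕ} (a b : Composition n) (i : Fin (numComp a b)) (v₀ : CMVertex a b) :
    Finset (CMVertex a b) :=
  (pathVertices a b i).filter (fun v => Odd ((cmGraph a b).dist v₀ v))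

/-- `ℬ_{c_i}`: the vertices on the path of `c_i` at even distance from the chosen vertex `v₀`. -/
def evenVertices {n : ℕ} (a b : Composition n) (i : Fin (numComp a b)) (v₀ : CMVertex a b) :
    Finset (CMVertex a b) :=
  (pathVertices a b i).filter (fun v => Even ((cmGraph a b).dist v₀ v))

/-- The peak set of the component `c_i`: the pairs `(A_I, A_J)`, standing for the blocks
`A_I × A_J`, for the oriented edges on the path of `c_i`. -/
def peakSet {n : ℕ} (a b : Composition n) (i : Fin (numComp a b)) :
    Finset (CMVertex a b × CMVertex a b) :=
  Finset.univ.filter (fun e => OnPath a b i e.1 ∧ OnPath a b i e.2 ∧ OrientedEdge a b e.1 e.2)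

/-! ## The functionals -/

/-- The functional `e_{i,j}^*` on `𝔤𝔩(n)`, for zero-based positions `i, j` (zero if there is no
such position, which never happens in the constructions below). -/
def entry (n i j : ℕ) : Module.Dual ℂ (Matrix (Fin n) (Fin n) ℂ) :=
  if h : i < n ∧ j < n then Matrix.entryLinearMap ℂ ℂ ⟨i, h.1⟩ ⟨j, h.2⟩ else 0

/-- The copy in `𝔤𝔩(n)^*` of a functional `F` on `𝔤𝔩(c)`, shifted by `m`: if
`F = ∑ γ_{p,q} e_{p,q}^*`, then this is `F^m = ∑ γ_{p,q} e_{p+m,q+m}^*`. -/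
def shift (n : ℕ) {c : ℕ} (F : Module.Dual ℂ (Matrix (Fin c) (Fin c) ℂ)) (m : ℕ) :
    Module.Dual ℂ (Matrix (Fin n) (Fin n) ℂ) :=
  ∑ p : Fin c, ∑ q : Fin c, F (Matrix.single p q 1) • entry n (p + m) (q + m)

/-- The rotation `F^R = ∑ γ_{p,q} e_{c+1-p,c+1-q}^*` of a functional `F = ∑ γ_{p,q} e_{p,q}^*` on
`𝔤𝔩(c)` (one-based indices). -/
def rotate {c : ℕ} (F : Module.Dual ℂ (Matrix (Fin c) (Fin c) ℂ)) :
    Module.Dual ℂ (Matrix (Fin c) (Fin c) ℂ) :=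
  ∑ p : Fin c, ∑ q : Fin c,
    F (Matrix.single p q 1) • Matrix.entryLinearMap ℂ ℂ (Fin.rev p) (Fin.rev q)

/-- The functional `F̄` on the seaweed of type `a / b`: a copy of `F_{c_i}` in each core block and
the main diagonal of each peak block. -/
def Fbar {n : ℕ} (a b : Composition n)
    (F : ∀ i : Fin (numComp a b),
      Module.Dual ℂ (Matrix (Fin (compSize a b i)) (Fin (compSize a b i)) ℂ)) :
    Module.Dual ℂ (seaweed a b) :=
  (∑ i : Fin (numComp a b),
    ((∑ v ∈ pathVertices a b i, shift n (F i) (minIdx a b v)) +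
      ∑ e ∈ peakSet a b i, ∑ s ∈ Finset.range (compSize a b i),
        entry n (minIdx a b e.1 + s) (minIdx a b e.2 + s))) ∘ₗ
    (seaweed a b).toSubmodule.subtype

/-- The functional `F̄ᵃ` on the seaweed of type `a / b`: a copy of `F_{c_i}` in each core block at
even distance from the chosen vertex `v₀ i`, a copy of its rotation in each core block at odd
distance, and the antidiagonal of each peak block (here `max A_I = min A_I + c_i - 1`). -/
def FbarA {n : ℕ} (a b : Composition n) (v₀ : Fin (numComp a b) → CMVertex a b)
    (F : ∀ i : Fin (numComp a b),
      Module.Dual ℂ (Matrix (Fin (compSize a b i)) (Fin (compSize a b i)) ℂ)) :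
    Module.Dual ℂ (seaweed a b) :=
  (∑ i : Fin (numComp a b),
    ((∑ v ∈ oddVertices a b i (v₀ i), shift n (rotate (F i)) (minIdx a b v)) +
      (∑ v ∈ evenVertices a b i (v₀ i), shift n (F i) (minIdx a b v)) +
      ∑ e ∈ peakSet a b i, ∑ s ∈ Finset.range (compSize a b i),
        entry n (minIdx a b e.1 + compSize a b i - 1 - s) (minIdx a b e.2 + s))) ∘ₗ
    (seaweed a b).toSubmodule.subtype

end Seaweed

end

/-!
The seaweed of type `a / b` consists of the matrices supported on `Supp`: an entry below the
diagonal may be nonzero only inside a top block, an entry above it only inside a bottom block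
(`mem_seaweed`). Testing the Kirillov form against matrix units turns membership in its kernel into
a system of linear equations in the entries (`mem_ker_kirillovForm_subalgebra`). Undoing the
winding-down moves shows that the seaweed arises from the component meander by replacing every
vertex by an interval, of the size of the component to which the vertex belongs
(`expands_signature`), so a matrix of the seaweed is a matrix of blocks indexed by the vertices of
the component meander. In these terms the equations have a *core part*, with the coefficients of
the `F_{c_i}`, and an *edge part*, which is the system for the functional `∑ e_{u,v}^*` over the
oriented edges `u → v` of the component meander, for each pair of offsets inside the blocks.

The edge part by itself is rigid: for a meander whose components are paths, the only solutions of
the edge equations in the seaweed of that meander are diagonal matrices. This is `Rigid`, and it is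
proved by induction over the moves (`Rigid.pure`, `Rigid.rot`): the equations express the entries
created by reversing a move through the old ones, and make the old entries a solution for the
smaller meander. Diagonal solutions are constant along the paths (`PathSystem.edge_rigid`).

The core part is a perturbation of lower order. As the components are paths, there is an integral
height `d` on the vertices which drops by one along every oriented edge. Give the block in row `v`
and column `u` the degree `d v - d u`. Each equation relates edge terms of one degree to core terms
of the degree below, so the lowest homogeneous part of a solution solves the edge equations
(`PathSystem.lowest`). Hence there is nothing in negative degree, and the part of degree zero is
block diagonal, with one matrix `Z_i` for each path. Adding the equations for the diagonal blocks
of a path cancels all edge terms, and what is left says that `Z_i` lies in the kernel of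
`B_{F_{c_i}}`. Conversely such `Z_i` give a solution, and subtracting it from the given one leaves
a solution without terms of degree at most zero, which vanishes (`PathSystem.exists_blockDiag`). So
the kernel is the direct sum of the kernels of the `B_{F_{c_i}}` (`dimKer_eq_sum`).

For the functional with antidiagonals in the peak blocks, the offsets are counted backwards in the
blocks at odd distance from the chosen vertices. Adjacent vertices have distances of opposite
parity (`odd_dist_iff`), so this turns the antidiagonals into diagonals and undoes the rotations,
and the same argument applies.
-/

namespace Seaweed

/-! ### Mirror images, seaweed support and rigidity -/

/-- The mirror image of the position `v` within its block, for consecutive blocks of the given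
sizes. Positions beyond the last block are fixed, which makes `mirror` an involution of `ℕ`. -/
def mirror : List ℕ → ℕ → ℕ
  | [], v => v
  | a :: l, v => if v < a then a - 1 - v else mirror l (v - a) + a

/-- The positions `u` and `v` lie in the same one of the consecutive blocks of the given sizes;
false if one of them lies beyond the last block. -/
def SameBlock : List ℕ → ℕ → ℕ → Prop
  | [], _, _ => False
  | a :: l, u, v => (u < a ∧ v < a) ∨ (a ≤ u ∧ a ≤ v ∧ SameBlock l (u - a) (v - a))

theorem mirror_mirror (l : List ℕ) (v : ℕ) : mirror l (mirror l v) = v := by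
  induction l generalizing v with
  | nil => rfl
  | cons a l ih => simp only [mirror]; split_ifs <;> grind

theorem SameBlock.symm {l : List ℕ} {u v : ℕ} (h : SameBlock l u v) : SameBlock l v u := by
  induction l generalizing u v with
  | nil => exact h
  | cons a l ih => simp only [SameBlock] at *; grind

theorem sameBlock_mirror {l : List ℕ} {v : ℕ} (hv : v < l.sum) : SameBlock l v (mirror l v) := by
  induction l generalizing v with
  | nil => simp at hv
  | cons a l ih =>
    simp only [SameBlock, mirror, List.sum_cons] at *
    split_ifs with h
    · omega
    · right
      refine ⟨by omega, by omega, ?_⟩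
      simpa using ih (v := v - a) (by omega)

theorem SameBlock.lt_sum {l : List ℕ} {u v : ℕ} (h : SameBlock l u v) : u < l.sum := by
  induction l generalizing u v with
  | nil => exact h.elim
  | cons a l ih =>
    simp only [SameBlock, List.sum_cons] at *
    rcases h with h | ⟨h1, h2, h3⟩
    · omega
    · have := ih h3; omega

theorem mirror_lt_sum {l : List ℕ} {v : ℕ} (hv : v < l.sum) : mirror l v < l.sum :=
  (sameBlock_mirror hv).symm.lt_sum

theorem mirror_of_sum_le {l : List ℕ} {v : ℕ} (hv : l.sum ≤ v) : mirror l v = v := by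
  induction l generalizing v with
  | nil => rfl
  | cons a l ih =>
    simp only [mirror, List.sum_cons] at *
    rw [if_neg (by omega), ih (by omega)]; omega

theorem sameBlock_refl {l : List ℕ} {v : ℕ} (hv : v < l.sum) : SameBlock l v v := by
  induction l generalizing v with
  | nil => simp at hv
  | cons a l ih =>
    simp only [SameBlock, List.sum_cons] at *
    by_cases h : v < a
    · exact Or.inl ⟨h, h⟩
    · exact Or.inr ⟨by omega, by omega, ih (by omega)⟩

/-- The entry in row `u` and column `v` is allowed to be nonzero in the seaweed of type `top / bot`:
on or below the diagonal `u` and `v` have to share a top block, on or above it a bottom block. -/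
def Supp (top bot : List ℕ) (u v : ℕ) : Prop :=
  (v ≤ u ∧ SameBlock top u v) ∨ (u ≤ v ∧ SameBlock bot u v)

/-- The value at `[x, e_{u,v}]` of the functional `∑ e_{p,q}^*`, summed over the oriented edges
`p → q` of the meander of type `top / bot` (top edges point left, bottom edges right). The first two
terms belong to the edges that end in `v`, the last two to those that start in `u`. -/
def defect (top bot : List ℕ) (x : ℕ → ℕ → ℂ) (u v : ℕ) : ℂ :=
  (if v < mirror top v then x (mirror top v) u else 0) +
    (if mirror bot v < v then x (mirror bot v) u else 0) -
    (if mirror top u < u then x v (mirror top u) else 0) -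
    (if u < mirror bot u then x v (mirror bot u) else 0)

/-- The kernel of the Kirillov form of `∑ e_{p,q}^*`, summed over the oriented edges of the meander
of type `top / bot`, consists of diagonal matrices. Matrices are functions on `ℕ × ℕ`; the support
condition keeps them inside the square of the meander. -/
def Rigid (top bot : List ℕ) : Prop :=
  ∀ x : ℕ → ℕ → ℂ, (∀ u v, ¬ Supp top bot u v → x u v = 0) →
    (∀ u v, Supp top bot u v → defect top bot x u v = 0) → ∀ u v, u ≠ v → x u v = 0

theorem Rigid.nil : Rigid [] [] := by
  intro x h _ u v _
  exact h u v (by simp [Supp, SameBlock])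

/-- Exchanging top and bottom amounts to transposing the matrix. -/
theorem Rigid.flip {t b : List ℕ} (h : Rigid t b) : Rigid b t := by
  intro x hx he u v huv
  refine h (fun u v => x v u) (fun u v h' => hx _ _ ?_) (fun u v h' => ?_) v u huv.symm
  · rintro (⟨h1, h2⟩ | ⟨h1, h2⟩)
    · exact h' (Or.inr ⟨h1, h2.symm⟩)
    · exact h' (Or.inl ⟨h1, h2.symm⟩)
  · have := he v u (by
      rcases h' with ⟨h1, h2⟩ | ⟨h1, h2⟩
      · exact (Or.inr ⟨h1, h2.symm⟩)
      · exact (Or.inl ⟨h1, h2.symm⟩))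
    simp only [defect] at *
    linear_combination -this

/-- Putting an isolated vertex in front of a rigid meander keeps it rigid. -/
theorem Rigid.unit {t b : List ℕ} (h : Rigid t b) : Rigid (1 :: t) (1 :: b) := by
  intro x hx he
  have key := h (fun u v => x (u + 1) (v + 1)) (fun u v h' => hx _ _ ?_) (fun u v h' => ?_)
  · intro u v huv
    rcases u with _ | u <;> rcases v with _ | v
    · exact (huv rfl).elim
    · exact hx _ _ (by simp [Supp, SameBlock])
    · exact hx _ _ (by simp [Supp, SameBlock])
    · exact key u v (by omega)
  · simpa [Supp, SameBlock] using h'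
  · have := he (u + 1) (v + 1) (by simpa [Supp, SameBlock] using h')
    simpa [defect, mirror] using this

/-! ### Rigidity under the reversal of a pure contraction -/

theorem mirror_cons_lt {a v : ℕ} (l : List ℕ) (h : v < a) : mirror (a :: l) v = a - 1 - v := by
  simp [mirror, h]

theorem mirror_cons_ge {a v : ℕ} (l : List ℕ) (h : a ≤ v) :
    mirror (a :: l) v = mirror l (v - a) + a := by
  simp [mirror, Nat.not_lt.2 h]

/-- Let `X` solve the edge equations for `(x+2y)|A / y|B`. In the last `y` rows of the first top
block, the columns of the first `y` vertices aside, `X` is the image of its first `y` rows and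
columns under the mirror symmetry of the block, extended by zero. This is the equation whose row
index is in the last `x + y` positions of the block and whose column index is one of the first `y`;
most of its terms lie outside the support. -/
theorem pure_block {x y : ℕ} {A B : List ℕ} {X : ℕ → ℕ → ℂ}
    (hX : ∀ u v, ¬ Supp ((x + 2 * y) :: A) (y :: B) u v → X u v = 0)
    (he : ∀ u v, Supp ((x + 2 * y) :: A) (y :: B) u v →
      defect ((x + 2 * y) :: A) (y :: B) X u v = 0) :
    ∀ u v, u < x + y → v < y →
      X (x + 2 * y - 1 - v) (x + 2 * y - 1 - u) = if u < y then X v u else 0 := by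
  have hright : ∀ u v, u < y → y ≤ v → X u v = 0 := fun u v h1 h2 => hX _ _ (by
    simp only [Supp, SameBlock]; omega)
  intro u v hu hv
  have := he (x + 2 * y - 1 - u) v (by simp only [Supp, SameBlock]; omega)
  simp only [defect, mirror_cons_lt A (show x + 2 * y - 1 - u < x + 2 * y by omega),
    mirror_cons_lt A (show v < x + 2 * y by omega), mirror_cons_lt B hv,
    mirror_cons_ge B (show y ≤ x + 2 * y - 1 - u by omega)] at this
  rw [if_pos (by omega), hright (y - 1 - v) _ (by omega) (by omega),
    hright v (mirror B _ + y) (by omega) (by omega)] at this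
  rw [show x + 2 * y - 1 - (x + 2 * y - 1 - u) = u by omega] at this
  split_ifs with h1
  · rw [if_pos (show u < x + 2 * y - 1 - u by omega)] at this
    simpa [sub_eq_zero] using this
  · rw [hright v u hv (by omega)] at this
    simpa using this

/-- The first top block of `(x+2y)|A` splits into blocks `x|y` on the old vertices: the entries in
the rows of `y` and the columns of `x` vanish. -/
theorem pure_zero {x y : ℕ} {A B : List ℕ} {X : ℕ → ℕ → ℂ}
    (hX : ∀ u v, ¬ Supp ((x + 2 * y) :: A) (y :: B) u v → X u v = 0)
    (he : ∀ u v, Supp ((x + 2 * y) :: A) (y :: B) u v →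
      defect ((x + 2 * y) :: A) (y :: B) X u v = 0) :
    ∀ u v, x + y ≤ u → u < x + 2 * y → y ≤ v → v < x + y → X u v = 0 := by
  have hblk := pure_block hX he
  intro u v h1 h2 h3 h4
  have := hblk (x + 2 * y - 1 - v) (x + 2 * y - 1 - u) (by omega) (by omega)
  rw [if_neg (by omega)] at this
  rwa [show x + 2 * y - 1 - (x + 2 * y - 1 - u) = u by omega,
    show x + 2 * y - 1 - (x + 2 * y - 1 - v) = v by omega] at this

/-- Restricting a solution for `(x+2y)|A / y|B` to the old vertices, those after the first `y`,
gives a matrix with the support of `x|y|A / B`. -/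
theorem pure_supp {x y : ℕ} {A B : List ℕ} {X : ℕ → ℕ → ℂ}
    (hX : ∀ u v, ¬ Supp ((x + 2 * y) :: A) (y :: B) u v → X u v = 0)
    (he : ∀ u v, Supp ((x + 2 * y) :: A) (y :: B) u v →
      defect ((x + 2 * y) :: A) (y :: B) X u v = 0) :
    ∀ u v, ¬ Supp (x :: y :: A) B u v → X (u + y) (v + y) = 0 := by
  have hmid := pure_zero hX he
  intro u v h'
  by_cases hs : Supp ((x + 2 * y) :: A) (y :: B) (u + y) (v + y)
  · simp only [Supp, SameBlock, Nat.add_sub_cancel] at hs h'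
    rw [show u + y - (x + 2 * y) = u - x - y by omega,
      show v + y - (x + 2 * y) = v - x - y by omega] at hs
    refine hmid _ _ ?_ ?_ ?_ ?_ <;> by_contra <;> clear hX he hmid <;> grind
  · exact hX _ _ hs

/-- Restricting a solution for `(x+2y)|A / y|B` to the old vertices gives a solution for
`x|y|A / B`. Up to terms that vanish, the only equations that are not equations of the larger
meander are those inside the block `y`, whose top edges the larger meander lacks. There the
equation at `(u, v)` is the sum of the equations of the larger meander at `(u, v)` and at its
mirror image in the first top block, since the new bottom block is a mirror image of the block `y`.
-/
theorem pure_defect {x y : ℕ} {A B : List ℕ} {X : ℕ → ℕ → ℂ}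
    (hX : ∀ u v, ¬ Supp ((x + 2 * y) :: A) (y :: B) u v → X u v = 0)
    (he : ∀ u v, Supp ((x + 2 * y) :: A) (y :: B) u v →
      defect ((x + 2 * y) :: A) (y :: B) X u v = 0) :
    ∀ u v, Supp (x :: y :: A) B u v →
      defect (x :: y :: A) B (fun u v => X (u + y) (v + y)) u v = 0 := by
  have hbelow : ∀ u v, x + 2 * y ≤ u → v < x + 2 * y → X u v = 0 := fun u v h1 h2 => hX _ _ (by
    simp only [Supp, SameBlock]; omega)
  have hblk := pure_block hX he
  have hmid := pure_zero hX he
  intro u v h'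
  have hS : Supp ((x + 2 * y) :: A) (y :: B) (u + y) (v + y) := by
    simp only [Supp, SameBlock, Nat.add_sub_cancel] at h' ⊢
    rw [show u + y - (x + 2 * y) = u - x - y by omega,
      show v + y - (x + 2 * y) = v - x - y by omega]
    clear hX he hbelow hmid hblk
    grind
  have hbot : ∀ w, mirror (y :: B) (w + y) = mirror B w + y := by
    intro w; rw [mirror_cons_ge B (by omega)]; simp
  have hrest : ∀ w, x + y ≤ w →
      mirror ((x + 2 * y) :: A) (w + y) = mirror (x :: y :: A) w + y := by
    intro w hw
    rw [mirror_cons_ge _ (by omega), mirror_cons_ge _ (by omega), mirror_cons_ge _ (by omega),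
      show w + y - (x + 2 * y) = w - x - y by omega]
    omega
  have hrest' : ∀ w, x + y ≤ w → x + y ≤ mirror (x :: y :: A) w := by
    intro w hw
    rw [mirror_cons_ge _ (by omega), mirror_cons_ge _ (by omega)]
    omega
  have hC : ∀ w, w < x → mirror ((x + 2 * y) :: A) (w + y) = mirror (x :: y :: A) w + y := by
    intro w hw
    rw [mirror_cons_lt _ (by omega), mirror_cons_lt _ (by omega)]
    omega
  have hC' : ∀ w, w < x → mirror (x :: y :: A) w < x := by
    intro w hw
    rw [mirror_cons_lt _ (by omega)]
    omega
  have hB : ∀ w, x ≤ w → w < x + y →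
      mirror ((x + 2 * y) :: A) (w + y) = x + y - 1 - w := by
    intro w hw hw'
    rw [mirror_cons_lt _ (by omega)]
    omega
  have hB' : ∀ w, x ≤ w → w < x + y → mirror (x :: y :: A) w = 2 * x + y - 1 - w := by
    intro w hw hw'
    rw [mirror_cons_ge _ (by omega), mirror_cons_lt _ (by omega)]
    omega
  have E1 := he _ _ hS
  simp only [defect, hbot, Nat.add_lt_add_iff_right] at E1 ⊢
  rcases Nat.lt_or_ge v (x + y) with hv | hv
  · have hu : u < x + y := by
      by_contra hu
      simp only [Supp, SameBlock] at h'
      omega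
    rcases Nat.lt_or_ge v x with hvx | hvx
    · have hux : u < x := by
        by_contra hu
        simp only [Supp, SameBlock] at h'
        omega
      rw [hC u hux, hC v hvx] at E1
      simpa using E1
    · rcases Nat.lt_or_ge u x with hux | hux
      · rw [hC u hux, hB v hvx hv, if_neg (show ¬ v + y < x + y - 1 - v by omega)] at E1
        rw [hB' v hvx hv, hmid (2 * x + y - 1 - v + y) (u + y) (by omega) (by omega) (by omega)
          (by omega)]
        simpa using E1
      · have E2 := he (x + y - 1 - u) (x + y - 1 - v) (by
          simp only [Supp, SameBlock] at h' ⊢; omega)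
        have k := hblk (x + y - 1 - u) (y - 1 - (x + y - 1 - v)) (by omega) (by omega)
        have k' := hblk (y - 1 - (x + y - 1 - u)) (x + y - 1 - v) (by omega) (by omega)
        rw [if_pos (by omega)] at k k'
        simp only [defect] at E2
        rw [mirror_cons_lt A (show x + y - 1 - u < x + 2 * y by omega),
          mirror_cons_lt A (show x + y - 1 - v < x + 2 * y by omega),
          mirror_cons_lt B (show x + y - 1 - u < y by omega),
          mirror_cons_lt B (show x + y - 1 - v < y by omega),
          ← k, ← k',
          if_pos (show x + y - 1 - v < x + 2 * y - 1 - (x + y - 1 - v) by omega),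
          if_neg (show ¬ x + 2 * y - 1 - (x + y - 1 - u) < x + y - 1 - u by omega)] at E2
        rw [hB u hux hu, hB v hvx hv, if_neg (show ¬ v + y < x + y - 1 - v by omega),
          if_pos (show x + y - 1 - u < u + y by omega)] at E1
        rw [hB' u hux hu, hB' v hvx hv]
        rw [show x + 2 * y - 1 - (x + y - 1 - v) = v + y by omega,
          show x + 2 * y - 1 - (x + y - 1 - u) = u + y by omega,
          show x + 2 * y - 1 - (y - 1 - (x + y - 1 - v)) = 2 * x + y - 1 - v + y by omega,
          show x + 2 * y - 1 - (y - 1 - (x + y - 1 - u)) = 2 * x + y - 1 - u + y by omega,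
          ] at E2
        simp only [show y - 1 - (x + y - 1 - v) < x + y - 1 - v ↔ v < 2 * x + y - 1 - v by omega,
          show x + y - 1 - u < y - 1 - (x + y - 1 - u) ↔ 2 * x + y - 1 - u < u by omega] at E2
        linear_combination E1 + E2
  · rw [hrest v hv] at E1
    rcases Nat.lt_or_ge u (x + y) with hu | hu
    · have z : mirror (x :: y :: A) u < x + y := by
        rcases Nat.lt_or_ge u x with hux | hux
        · have := hC' u hux; omega
        · have := hB' u hux hu; omega
      have z' : mirror ((x + 2 * y) :: A) (u + y) < x + 2 * y := by
        rw [mirror_cons_lt _ (by omega)]; omega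
      rw [hbelow _ _ (by omega) z'] at E1
      rw [hbelow (v + y) (mirror (x :: y :: A) u + y) (by omega) (by omega)]
      simpa using E1
    · rw [hrest u hu] at E1
      simpa using E1

/-- Reversing a pure contraction, `x|y|A / B ↦ (x+2y)|A / y|B`, preserves rigidity. For `x = 0`
this covers the reversal of a block elimination. -/
theorem Rigid.pure {x y : ℕ} {A B : List ℕ} (h : Rigid (x :: y :: A) B) :
    Rigid ((x + 2 * y) :: A) (y :: B) := by
  intro X hX he
  have hright : ∀ u v, u < y → y ≤ v → X u v = 0 := fun u v h1 h2 => hX _ _ (by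
    simp only [Supp, SameBlock]; omega)
  have hbelow : ∀ u v, x + 2 * y ≤ u → v < x + 2 * y → X u v = 0 := fun u v h1 h2 => hX _ _ (by
    simp only [Supp, SameBlock]; omega)
  have hblk := pure_block hX he
  have hd := pure_defect hX he
  have H := h _ (pure_supp hX he) hd
  have H' : ∀ u v, y ≤ u → y ≤ v → u ≠ v → X u v = 0 := by
    intro u v hu hv huv
    have := H (u - y) (v - y) (by omega)
    simpa [Nat.sub_add_cancel hu, Nat.sub_add_cancel hv] using this
  have HB : ∀ u v, u < y → v < y → u ≠ v → X u v = 0 := by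
    intro u v hu hv huv
    have := hblk v u (by omega) hu
    rw [if_pos hv] at this
    rw [← this]
    exact H' _ _ (by omega) (by omega) (by omega)
  -- Bottom edges of new vertices mirror top edges of the block `y`, whose ends have equal diagonal
  -- entries.
  have Hc : ∀ q, q < y → q < y - 1 - q → X q q = X (y - 1 - q) (y - 1 - q) := by
    intro q hq hq'
    have k1 := hblk q q (by omega) hq
    have k2 := hblk (y - 1 - q) (y - 1 - q) (by omega) (by omega)
    rw [if_pos (by omega)] at k1 k2
    rw [← k1, ← k2]
    have E := hd (x + y - 1 - q) (x + q) (by simp only [Supp, SameBlock]; omega)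
    simp only [defect] at E
    have m1 : mirror (x :: y :: A) (x + q) = x + y - 1 - q := by
      rw [mirror_cons_ge _ (by omega), mirror_cons_lt _ (by omega)]
      omega
    have m2 : mirror (x :: y :: A) (x + y - 1 - q) = x + q := by
      rw [mirror_cons_ge _ (by omega), mirror_cons_lt _ (by omega)]
      omega
    rw [m1, m2, if_pos (show x + q < x + y - 1 - q by omega),
      if_pos (show x + q < x + y - 1 - q by omega)] at E
    have e1 : (if mirror B (x + q) < x + q then X (mirror B (x + q) + y) (x + y - 1 - q + y)
        else 0) = 0 := by
      split_ifs
      · exact H' _ _ (by omega) (by omega) (by omega)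
      · rfl
    have e2 : (if x + y - 1 - q < mirror B (x + y - 1 - q) then
        X (x + q + y) (mirror B (x + y - 1 - q) + y) else 0) = 0 := by
      split_ifs
      · exact H' _ _ (by omega) (by omega) (by omega)
      · rfl
    rw [e1, e2] at E
    rw [show x + 2 * y - 1 - q = x + y - 1 - q + y by omega,
      show x + 2 * y - 1 - (y - 1 - q) = x + q + y by omega]
    linear_combination E
  intro p q hpq
  rcases Nat.lt_or_ge p y with hp | hp
  · rcases Nat.lt_or_ge q y with hq | hq
    · exact HB p q hp hq hpq
    · exact hright p q hp hq
  rcases Nat.lt_or_ge q y with hq | hq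
  swap
  · exact H' p q hp hq hpq
  rcases Nat.lt_or_ge p (x + 2 * y) with hp2 | hp2
  swap
  · exact hbelow p q hp2 (by omega)
  -- Now `p` is an old vertex of the first top block and `q` a new one. The top edge from the mirror
  -- image of `q` gives the claim for `p < x + y`, and the one from `p` for the remaining `p`.
  rcases Nat.lt_or_ge p (x + y) with hp3 | hp3
  · have E := he (x + 2 * y - 1 - q) p (by simp only [Supp, SameBlock]; omega)
    simp only [defect] at E
    rw [mirror_cons_lt A (show x + 2 * y - 1 - q < x + 2 * y by omega),
      mirror_cons_lt A hp2, mirror_cons_ge B hp,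
      mirror_cons_ge B (show y ≤ x + 2 * y - 1 - q by omega),
      H' (x + 2 * y - 1 - p) _ (by omega) (by omega) (by omega),
      show x + 2 * y - 1 - (x + 2 * y - 1 - q) = q by omega,
      if_pos (show q < x + 2 * y - 1 - q by omega)] at E
    have e1 : (if mirror B (p - y) + y < p then X (mirror B (p - y) + y) (x + 2 * y - 1 - q)
        else 0) = 0 := by
      split_ifs
      · exact H' _ _ (by omega) (by omega) (by omega)
      · rfl
    have e2 : (if x + 2 * y - 1 - q < mirror B (x + 2 * y - 1 - q - y) + y then
        X p (mirror B (x + 2 * y - 1 - q - y) + y) else 0) = 0 := by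
      split_ifs
      · exact H' _ _ (by omega) (by omega) (by omega)
      · rfl
    rw [e1, e2] at E
    simpa using E
  · have E := he q (x + 2 * y - 1 - p) (by simp only [Supp, SameBlock]; omega)
    simp only [defect] at E
    rw [mirror_cons_lt A (show x + 2 * y - 1 - p < x + 2 * y by omega),
      mirror_cons_lt A (show q < x + 2 * y by omega), mirror_cons_lt B hq,
      mirror_cons_lt B (show x + 2 * y - 1 - p < y by omega),
      show x + 2 * y - 1 - (x + 2 * y - 1 - p) = p by omega,
      if_pos (show x + 2 * y - 1 - p < p by omega),
      if_neg (show ¬ x + 2 * y - 1 - q < q by omega)] at E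
    by_cases hc : x + 2 * y - 1 - p = y - 1 - q
    · rw [hc, show y - 1 - (y - 1 - q) = q by omega] at E
      by_cases hlt : q < y - 1 - q
      · rw [if_pos hlt, if_pos hlt, Hc q hq hlt] at E
        simpa using E
      · rw [if_neg hlt, if_neg hlt] at E
        simpa using E
    · rw [HB (y - 1 - (x + 2 * y - 1 - p)) q (by omega) (by omega) (by omega),
        HB (x + 2 * y - 1 - p) (y - 1 - q) (by omega) (by omega) hc] at E
      simpa using E

/-! ### Rigidity under the reversal of a rotation contraction -/

/-- Let `X` solve the edge equations for `(2x-y)|A / x|B`. In the columns of the first `x - y`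
vertices and the rows of the first bottom block, `X` is the image of the last `x - y` rows and
columns of the first top block under the mirror symmetry of that block, extended by zero. -/
theorem rot_block {x y : ℕ} {A B : List ℕ} {X : ℕ → ℕ → ℂ} (hyx : y ≤ x)
    (hX : ∀ u v, ¬ Supp ((2 * x - y) :: A) (x :: B) u v → X u v = 0)
    (he : ∀ u v, Supp ((2 * x - y) :: A) (x :: B) u v →
      defect ((2 * x - y) :: A) (x :: B) X u v = 0) :
    ∀ u v, u < x - y → v < x →
      X v u = if v < x - y then X (2 * x - y - 1 - v) (2 * x - y - 1 - u) else 0 := by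
  intro u v hu hv
  have hright : ∀ u v, u < x → x ≤ v → X u v = 0 := fun u v h1 h2 => hX _ _ (by
    simp only [Supp, SameBlock]; omega)
  have E := he (2 * x - y - 1 - u) v (by simp only [Supp, SameBlock]; omega)
  simp only [defect, mirror_cons_lt A (show 2 * x - y - 1 - u < 2 * x - y by omega),
    mirror_cons_lt A (show v < 2 * x - y by omega), mirror_cons_lt B hv,
    mirror_cons_ge B (show x ≤ 2 * x - y - 1 - u by omega)] at E
  rw [hright (x - 1 - v) _ (by omega) (by omega),
    hright v (mirror B _ + x) (by omega) (by omega),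
    show 2 * x - y - 1 - (2 * x - y - 1 - u) = u by omega,
    if_pos (show u < 2 * x - y - 1 - u by omega)] at E
  split_ifs with h1
  · rw [if_pos (show v < 2 * x - y - 1 - v by omega)] at E
    simp only [ite_self] at E
    linear_combination -E
  · rw [hright (2 * x - y - 1 - v) _ (by omega) (by omega)] at E
    simpa using E

/-- The matrix for `x|A / y|B` obtained from a matrix `X` for `(2x-y)|A / x|B`: on the first top
block of size `x` it is read off from the mirror image of the first bottom block of `X`, and on the
vertices after the first `y` it is `X` itself, shifted. By `rotContract_ge` the two descriptions
agree where both apply if `X` solves the edge equations. -/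
def rotContract (x y : ℕ) (X : ℕ → ℕ → ℂ) (p q : ℕ) : ℂ :=
  if p < x ∧ q < x then X (x - 1 - p) (x - 1 - q)
  else if y ≤ p ∧ y ≤ q then X (p + (x - y)) (q + (x - y)) else 0

theorem rotContract_lt {x y : ℕ} {X : ℕ → ℕ → ℂ} {p q : ℕ} (hp : p < x) (hq : q < x) :
    rotContract x y X p q = X (x - 1 - p) (x - 1 - q) := by
  simp [rotContract, hp, hq]

/-- On the vertices after the first `y`, the contraction of a solution is a shift of the solution,
also where it is defined by the mirror image. -/
theorem rotContract_ge {x y : ℕ} {A B : List ℕ} {X : ℕ → ℕ → ℂ} (hyx : y ≤ x)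
    (hX : ∀ u v, ¬ Supp ((2 * x - y) :: A) (x :: B) u v → X u v = 0)
    (he : ∀ u v, Supp ((2 * x - y) :: A) (x :: B) u v →
      defect ((2 * x - y) :: A) (x :: B) X u v = 0) {p q : ℕ} (hp : y ≤ p) (hq : y ≤ q) :
    rotContract x y X p q = X (p + (x - y)) (q + (x - y)) := by
  unfold rotContract
  split_ifs with h1 h2
  · rw [rot_block hyx hX he (x - 1 - q) (x - 1 - p) (by omega) (by omega), if_pos (by omega)]
    congr 1 <;> omega
  · rfl
  · omega

theorem rotContract_zero {x y : ℕ} {A B : List ℕ} {X : ℕ → ℕ → ℂ} (hyx : y ≤ x)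
    (hX : ∀ u v, ¬ Supp ((2 * x - y) :: A) (x :: B) u v → X u v = 0)
    (he : ∀ u v, Supp ((2 * x - y) :: A) (x :: B) u v →
      defect ((2 * x - y) :: A) (x :: B) X u v = 0) {p q : ℕ} (hp : p < y) (hq : y ≤ q) :
    rotContract x y X p q = 0 := by
  unfold rotContract
  split_ifs with h1 h2
  · rw [rot_block hyx hX he (x - 1 - q) (x - 1 - p) (by omega) (by omega), if_neg (by omega)]
  · omega
  · rfl

/-- The contraction of a solution for `(2x-y)|A / x|B` has the support of `x|A / y|B`. -/
theorem rot_supp {x y : ℕ} {A B : List ℕ} {X : ℕ → ℕ → ℂ} (hyx : y ≤ x)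
    (hX : ∀ u v, ¬ Supp ((2 * x - y) :: A) (x :: B) u v → X u v = 0)
    (he : ∀ u v, Supp ((2 * x - y) :: A) (x :: B) u v →
      defect ((2 * x - y) :: A) (x :: B) X u v = 0) :
    ∀ u v, ¬ Supp (x :: A) (y :: B) u v → rotContract x y X u v = 0 := by
  intro u v h'
  rcases Nat.lt_or_ge u y with hu | hu
  · rcases Nat.lt_or_ge v y with hv | hv
    · simp only [Supp, SameBlock] at h'
      omega
    · exact rotContract_zero hyx hX he hu hv
  · rcases Nat.lt_or_ge v y with hv | hv
    · have : x ≤ u := by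
        by_contra
        simp only [Supp, SameBlock] at h'
        omega
      rw [rotContract, if_neg (by omega), if_neg (by omega)]
    · rw [rotContract_ge hyx hX he hu hv]
      refine hX _ _ fun hs => h' ?_
      simp only [Supp, SameBlock] at hs ⊢
      rw [show u + (x - y) - (2 * x - y) = u - x by omega,
        show v + (x - y) - (2 * x - y) = v - x by omega,
        show u + (x - y) - x = u - y by omega, show v + (x - y) - x = v - y by omega] at hs
      clear hX he h'
      grind

/-- The contraction of a solution for `(2x-y)|A / x|B` solves the edge equations for `x|A / y|B`. In
the overlap of the first top block with the vertices after the first `y`, the equation is the sum of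
two equations of the larger meander, whose superfluous terms cancel; elsewhere one of them is
enough. -/
theorem rot_defect {x y : ℕ} {A B : List ℕ} {X : ℕ → ℕ → ℂ} (hyx : y ≤ x)
    (hX : ∀ u v, ¬ Supp ((2 * x - y) :: A) (x :: B) u v → X u v = 0)
    (he : ∀ u v, Supp ((2 * x - y) :: A) (x :: B) u v →
      defect ((2 * x - y) :: A) (x :: B) X u v = 0) :
    ∀ u v, Supp (x :: A) (y :: B) u v →
      defect (x :: A) (y :: B) (rotContract x y X) u v = 0 := by
  intro u v h'
  have hbelow : ∀ u v, 2 * x - y ≤ u → v < 2 * x - y → X u v = 0 := fun u v h1 h2 => hX _ _ (by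
    simp only [Supp, SameBlock]; omega)
  have hge := @rotContract_ge x y A B X hyx hX he
  have hbot : ∀ w, y ≤ w →
      mirror (x :: B) (w + (x - y)) = mirror (y :: B) w + (x - y) := by
    intro w hw
    rw [mirror_cons_ge B (by omega), mirror_cons_ge B hw, show w + (x - y) - x = w - y by omega]
    omega
  have hbot' : ∀ w, y ≤ w → y ≤ mirror (y :: B) w := by
    intro w hw; rw [mirror_cons_ge B hw]; omega
  have htop : ∀ w, x ≤ w →
      mirror ((2 * x - y) :: A) (w + (x - y)) = mirror (x :: A) w + (x - y) := by
    intro w hw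
    rw [mirror_cons_ge A (by omega), mirror_cons_ge A hw,
      show w + (x - y) - (2 * x - y) = w - x by omega]
    omega
  have htop' : ∀ w, x ≤ w → x ≤ mirror (x :: A) w := by
    intro w hw; rw [mirror_cons_ge A hw]; omega
  by_cases hy : y ≤ u ∧ y ≤ v
  · obtain ⟨hu, hv⟩ := hy
    have E1 := he (u + (x - y)) (v + (x - y)) (by
      simp only [Supp, SameBlock] at h' ⊢
      rw [show u + (x - y) - (2 * x - y) = u - x by omega,
        show v + (x - y) - (2 * x - y) = v - x by omega,
        show u + (x - y) - x = u - y by omega, show v + (x - y) - x = v - y by omega]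
      clear hX he hge hbelow hbot hbot' htop htop'
      grind)
    simp only [defect, hbot u hu, hbot v hv, Nat.add_lt_add_iff_right] at E1
    simp only [defect]
    rw [hge (hbot' v hv) hu, hge hv (hbot' u hu)]
    rcases Nat.lt_or_ge v x with hvx | hvx
    · have hux : u < x := by
        by_contra
        simp only [Supp, SameBlock] at h'
        omega
      have E2 := he (x - 1 - u) (x - 1 - v) (by
        simp only [Supp, SameBlock]; omega)
      simp only [defect] at E2
      rw [mirror_cons_lt A (show x - 1 - u < 2 * x - y by omega),
        mirror_cons_lt A (show x - 1 - v < 2 * x - y by omega),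
        mirror_cons_lt B (show x - 1 - u < x by omega),
        mirror_cons_lt B (show x - 1 - v < x by omega),
        show 2 * x - y - 1 - (x - 1 - u) = u + (x - y) by omega,
        show 2 * x - y - 1 - (x - 1 - v) = v + (x - y) by omega,
        show x - 1 - (x - 1 - u) = u by omega, show x - 1 - (x - 1 - v) = v by omega,
        if_pos (show x - 1 - v < v + (x - y) by omega),
        if_neg (show ¬ u + (x - y) < x - 1 - u by omega)] at E2
      rw [mirror_cons_lt A (show u + (x - y) < 2 * x - y by omega),
        mirror_cons_lt A (show v + (x - y) < 2 * x - y by omega),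
        show 2 * x - y - 1 - (u + (x - y)) = x - 1 - u by omega,
        show 2 * x - y - 1 - (v + (x - y)) = x - 1 - v by omega,
        if_neg (show ¬ v + (x - y) < x - 1 - v by omega),
        if_pos (show x - 1 - u < u + (x - y) by omega)] at E1
      rw [mirror_cons_lt A hux, mirror_cons_lt A hvx,
        rotContract_lt (show x - 1 - v < x by omega) hux,
        rotContract_lt hvx (show x - 1 - u < x by omega),
        show x - 1 - (x - 1 - u) = u by omega, show x - 1 - (x - 1 - v) = v by omega]
      linear_combination E1 + E2
    · have hv' := htop' v hvx
      rw [htop v hvx] at E1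
      rw [hge (by omega) hu]
      rcases Nat.lt_or_ge u x with hux | hux
      · rw [mirror_cons_lt A (show u + (x - y) < 2 * x - y by omega),
          hbelow _ (2 * x - y - 1 - (u + (x - y))) (by omega) (by omega)] at E1
        have z : rotContract x y X v (mirror (x :: A) u) = 0 := by
          rw [mirror_cons_lt A hux]
          unfold rotContract
          rw [if_neg (by omega)]
          split_ifs
          · exact hbelow _ _ (by omega) (by omega)
          · rfl
        rw [z]
        simpa using E1
      · have hu' := htop' u hux
        rw [htop u hux] at E1
        rw [hge hv (by omega)]
        simpa using E1
  · have hvy : v < y := by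
      by_contra
      simp only [Supp, SameBlock] at h'
      omega
    have hux : u < x := by
      by_contra
      simp only [Supp, SameBlock] at h'
      omega
    have E2 := he (x - 1 - u) (x - 1 - v) (by
      simp only [Supp, SameBlock] at h' ⊢; omega)
    simp only [defect] at E2 ⊢
    rw [mirror_cons_lt A (show x - 1 - u < 2 * x - y by omega),
      mirror_cons_lt A (show x - 1 - v < 2 * x - y by omega),
      mirror_cons_lt B (show x - 1 - u < x by omega),
      mirror_cons_lt B (show x - 1 - v < x by omega),
      show 2 * x - y - 1 - (x - 1 - u) = u + (x - y) by omega,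
      show 2 * x - y - 1 - (x - 1 - v) = v + (x - y) by omega,
      show x - 1 - (x - 1 - u) = u by omega, show x - 1 - (x - 1 - v) = v by omega] at E2
    rw [mirror_cons_lt A hux, mirror_cons_lt A (show v < x by omega), mirror_cons_lt B hvy,
      rotContract_lt (show x - 1 - v < x by omega) hux,
      rotContract_lt (show v < x by omega) (show x - 1 - u < x by omega),
      rotContract_lt (show y - 1 - v < x by omega) hux,
      show x - 1 - (x - 1 - u) = u by omega, show x - 1 - (x - 1 - v) = v by omega,
      show x - 1 - (y - 1 - v) = v + (x - y) by omega]
    simp only [show x - 1 - v < v + (x - y) ↔ y - 1 - v < v by omega] at E2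
    rcases Nat.lt_or_ge u y with huy | huy
    · rw [mirror_cons_lt B huy, rotContract_lt (show v < x by omega) (show y - 1 - u < x by omega),
        show x - 1 - (y - 1 - u) = u + (x - y) by omega]
      simp only [show u + (x - y) < x - 1 - u ↔ u < y - 1 - u by omega] at E2
      linear_combination E2
    · rw [rotContract_zero hyx hX he hvy (hbot' u huy)]
      rw [if_neg (show ¬ u + (x - y) < x - 1 - u by omega)] at E2
      rw [ite_self]
      linear_combination E2

/-- Reversing a rotation contraction, `x|A / y|B ↦ (2x-y)|A / x|B` with `y ≤ x`, preserves
rigidity. -/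
theorem Rigid.rot {x y : ℕ} {A B : List ℕ} (hyx : y ≤ x) (h : Rigid (x :: A) (y :: B)) :
    Rigid ((2 * x - y) :: A) (x :: B) := by
  intro X hX he
  have hright : ∀ u v, u < x → x ≤ v → X u v = 0 := fun u v h1 h2 => hX _ _ (by
    simp only [Supp, SameBlock]; omega)
  have hbelow : ∀ u v, 2 * x - y ≤ u → v < 2 * x - y → X u v = 0 := fun u v h1 h2 => hX _ _ (by
    simp only [Supp, SameBlock]; omega)
  have hd := rot_defect hyx hX he
  have H := h _ (rot_supp hyx hX he) hd
  have HB : ∀ u v, u < x → v < x → u ≠ v → X u v = 0 := by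
    intro u v hu hv huv
    have := H (x - 1 - u) (x - 1 - v) (by omega)
    rwa [rotContract_lt (by omega) (by omega), show x - 1 - (x - 1 - u) = u by omega,
      show x - 1 - (x - 1 - v) = v by omega] at this
  -- Bottom edges in the first bottom block mirror top edges of the old meander, whose ends have
  -- equal diagonal entries in the contraction.
  have Hc : ∀ q, q < x → q < x - 1 - q → X q q = X (x - 1 - q) (x - 1 - q) := by
    intro q hq hq'
    have E := hd (x - 1 - q) q (by simp only [Supp, SameBlock]; omega)
    simp only [defect] at E
    rw [mirror_cons_lt A hq, mirror_cons_lt A (show x - 1 - q < x by omega),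
      show x - 1 - (x - 1 - q) = q by omega, if_pos hq', if_pos hq',
      rotContract_lt hq hq, rotContract_lt (by omega) (by omega),
      show x - 1 - (x - 1 - q) = q by omega] at E
    have e1 : (if mirror (y :: B) q < q then
        rotContract x y X (mirror (y :: B) q) (x - 1 - q) else 0) = 0 := by
      split_ifs
      · exact H _ _ (by omega)
      · rfl
    have e2 : (if x - 1 - q < mirror (y :: B) (x - 1 - q) then
        rotContract x y X q (mirror (y :: B) (x - 1 - q)) else 0) = 0 := by
      split_ifs
      · exact H _ _ (by omega)
      · rfl
    rw [e1, e2] at E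
    linear_combination E
  intro p q hpq
  rcases Nat.lt_or_ge p x with hp | hp
  · rcases Nat.lt_or_ge q x with hq | hq
    · exact HB p q hp hq hpq
    · exact hright p q hp hq
  rcases Nat.lt_or_ge q x with hq | hq
  swap
  · have := H (p - (x - y)) (q - (x - y)) (by omega)
    rwa [rotContract_ge hyx hX he (by omega) (by omega), Nat.sub_add_cancel (by omega),
      Nat.sub_add_cancel (by omega)] at this
  rcases Nat.lt_or_ge p (2 * x - y) with hp2 | hp2
  swap
  · exact hbelow p q hp2 (by omega)
  -- The remaining entries, below the first bottom block, occur with the top edge starting in `p`.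
  have E := he q (2 * x - y - 1 - p) (by simp only [Supp, SameBlock]; omega)
  simp only [defect] at E
  rw [mirror_cons_lt A (show 2 * x - y - 1 - p < 2 * x - y by omega),
    mirror_cons_lt A (show q < 2 * x - y by omega), mirror_cons_lt B hq,
    mirror_cons_lt B (show 2 * x - y - 1 - p < x by omega),
    show 2 * x - y - 1 - (2 * x - y - 1 - p) = p by omega,
    if_pos (show 2 * x - y - 1 - p < p by omega)] at E
  have e0 : (if 2 * x - y - 1 - q < q then X (2 * x - y - 1 - p) (2 * x - y - 1 - q) else 0)
      = 0 := by
    split_ifs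
    · exact HB _ _ (by omega) (by omega) (by omega)
    · rfl
  rw [e0] at E
  by_cases hc : 2 * x - y - 1 - p = x - 1 - q
  · rw [hc, show x - 1 - (x - 1 - q) = q by omega] at E
    by_cases hlt : q < x - 1 - q
    · rw [if_pos hlt, if_pos hlt, Hc q hq hlt] at E
      simpa using E
    · rw [if_neg hlt, if_neg hlt] at E
      simpa using E
  · rw [HB (x - 1 - (2 * x - y - 1 - p)) q (by omega) (by omega) (by omega),
      HB (2 * x - y - 1 - p) (x - 1 - q) (by omega) (by omega) hc] at E
    simpa using E

/-! ### Meanders that are unions of labelled paths -/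

/-- What is needed of a meander whose components are paths and whose vertices are labelled by the
component to which they belong: both mirror involutions preserve the labels, the vertices with a
given label are connected (a property invariant under both involutions is constant on them), the
oriented edges admit a height function, and the edge equations have diagonal solutions only.
Positions beyond the last vertex are fixed by both involutions and have label `none`. -/
structure PathMeander (top bot label : List ℕ) : Prop where
  top_sum : top.sum = label.length
  bot_sum : bot.sum = label.length
  label_top : ∀ v : ℕ, label[mirror top v]? = label[v]?
  label_bot : ∀ v : ℕ, label[mirror bot v]? = label[v]?
  connected : ∀ g : ℕ → Prop, (∀ v, g (mirror top v) ↔ g v) → (∀ v, g (mirror bot v) ↔ g v) →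
    ∀ u v : ℕ, u < label.length → label[u]? = label[v]? → (g u ↔ g v)
  graded : ∃ d : ℕ → ℤ, (∀ v, v < mirror top v → d (mirror top v) = d v + 1) ∧
    ∀ v, mirror bot v < v → d (mirror bot v) = d v + 1
  rigid : Rigid top bot

theorem PathMeander.nil : PathMeander [] [] [] where
  top_sum := rfl
  bot_sum := rfl
  label_top _ := rfl
  label_bot _ := rfl
  connected _ _ _ u v hu := by simp at hu
  graded := ⟨fun _ => 0, by simp [mirror], by simp [mirror]⟩
  rigid := Rigid.nil

theorem PathMeander.flip {t b l : List ℕ} (h : PathMeander t b l) : PathMeander b t l where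
  top_sum := h.bot_sum
  bot_sum := h.top_sum
  label_top := h.label_bot
  label_bot := h.label_top
  connected g h1 h2 := h.connected g h2 h1
  graded := by
    obtain ⟨d, h1, h2⟩ := h.graded
    refine ⟨fun v => - d v, fun v hv => ?_, fun v hv => ?_⟩
    · have := h2 (mirror b v) (by rwa [mirror_mirror])
      rw [mirror_mirror] at this
      beta_reduce
      omega
    · have := h1 (mirror t v) (by rwa [mirror_mirror])
      rw [mirror_mirror] at this
      beta_reduce
      omega
  rigid := h.rigid.flip

theorem mirror_zero_cons (l : List ℕ) : mirror (0 :: l) = mirror l := by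
  funext v; simp [mirror]

theorem sameBlock_zero_cons (l : List ℕ) : SameBlock (0 :: l) = SameBlock l := by
  funext u v; simp [SameBlock]

/-- An empty top block may be put in front. With this, the reversal of a block elimination is the
case `x = 0` of the reversal of a pure contraction. -/
theorem PathMeander.zero {t b l : List ℕ} (h : PathMeander t b l) : PathMeander (0 :: t) b l where
  top_sum := by simpa using h.top_sum
  bot_sum := h.bot_sum
  label_top := by rw [mirror_zero_cons]; exact h.label_top
  label_bot := h.label_bot
  connected := by rw [mirror_zero_cons]; exact h.connected
  graded := by rw [mirror_zero_cons]; exact h.graded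
  rigid := by
    have := h.rigid
    simpa only [Rigid, Supp, defect, mirror_zero_cons, sameBlock_zero_cons] using this

theorem mirror_one_cons_zero (l : List ℕ) : mirror (1 :: l) 0 = 0 := by simp [mirror]

theorem mirror_one_cons_succ (l : List ℕ) (v : ℕ) :
    mirror (1 :: l) (v + 1) = mirror l v + 1 := by simp [mirror]

theorem PathMeander.unit {t b l : List ℕ} (h : PathMeander t b l) :
    PathMeander (1 :: t) (1 :: b) (0 :: l.map Nat.succ) where
  top_sum := by simp [h.top_sum, add_comm]
  bot_sum := by simp [h.bot_sum, add_comm]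
  label_top v := by
    rcases v with _ | v
    · rw [mirror_one_cons_zero]
    · simp [mirror_one_cons_succ, h.label_top]
  label_bot v := by
    rcases v with _ | v
    · rw [mirror_one_cons_zero]
    · simp [mirror_one_cons_succ, h.label_bot]
  connected g h1 h2 u v hu huv := by
    have key := h.connected (fun v => g (v + 1))
      (fun v => by simpa only [mirror_one_cons_succ] using h1 (v + 1))
      (fun v => by simpa only [mirror_one_cons_succ] using h2 (v + 1))
    rcases u with _ | u <;> rcases v with _ | v
    · rfl
    · exfalso
      simp only [List.getElem?_cons_zero, List.getElem?_cons_succ, List.getElem?_map] at huv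
      cases hv : l[v]? <;> simp [hv] at huv
    · exfalso
      simp only [List.getElem?_cons_zero, List.getElem?_cons_succ, List.getElem?_map] at huv
      cases hv : l[u]? <;> simp [hv] at huv
    · refine key u v (by simpa using hu) ?_
      simp only [List.getElem?_cons_succ, List.getElem?_map] at huv
      exact Option.map_injective Nat.succ_injective huv
  graded := by
    obtain ⟨d, h1, h2⟩ := h.graded
    refine ⟨fun v => d (v - 1), fun v hv => ?_, fun v hv => ?_⟩
    · rcases v with _ | v
      · simp [mirror_one_cons_zero] at hv
      · rw [mirror_one_cons_succ] at *
        exact h1 v (by omega)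
    · rcases v with _ | v
      · simp [mirror_one_cons_zero] at hv
      · rw [mirror_one_cons_succ] at *
        exact h2 v (by omega)
  rigid := h.rigid.unit

theorem PathMeander.pure {x y : ℕ} {A B l : List ℕ} (h : PathMeander (x :: y :: A) B l) :
    PathMeander ((x + 2 * y) :: A) (y :: B) (((l.drop x).take y).reverse ++ l) := by
  have hlen : x + y ≤ l.length := by
    have := h.top_sum; simp only [List.sum_cons] at this; omega
  have hlab : ∀ v : ℕ, (((l.drop x).take y).reverse ++ l)[v]? =
      l[if v < y then x + y - 1 - v else v - y]? := by
    intro v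
    have h1 : ((l.drop x).take y).length = y := by simp; omega
    split_ifs with hv
    · rw [List.getElem?_append_left (by simp; omega), List.getElem?_reverse (by omega), h1,
        List.getElem?_take, if_pos (by omega), List.getElem?_drop]
      congr 1; omega
    · rw [List.getElem?_append_right (by simp; omega), List.length_reverse, h1]
  have hbot : ∀ w, mirror (y :: B) (w + y) = mirror B w + y := by
    intro w; rw [mirror_cons_ge B (by omega)]; simp
  have hrest : ∀ w, w < x ∨ x + y ≤ w →
      mirror ((x + 2 * y) :: A) (w + y) = mirror (x :: y :: A) w + y := by
    rintro w (hw | hw)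
    · rw [mirror_cons_lt _ (by omega), mirror_cons_lt _ (by omega)]
      omega
    · rw [mirror_cons_ge _ (by omega), mirror_cons_ge _ (by omega), mirror_cons_ge _ (by omega),
        show w + y - (x + 2 * y) = w - x - y by omega]
      omega
  have hB : ∀ w, x ≤ w → w < x + y →
      mirror ((x + 2 * y) :: A) (w + y) = x + y - 1 - w := by
    intro w hw hw'
    rw [mirror_cons_lt _ (by omega)]
    omega
  have hB' : ∀ w, x ≤ w → w < x + y → mirror (x :: y :: A) w = 2 * x + y - 1 - w := by
    intro w hw hw'
    rw [mirror_cons_ge _ (by omega), mirror_cons_lt _ (by omega)]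
    omega
  refine ⟨?_, ?_, fun v => ?_, fun v => ?_, fun g h1 h2 => ?_, ?_, h.rigid.pure⟩
  · have := h.top_sum
    simp only [List.sum_cons, List.length_append, List.length_reverse, List.length_take,
      List.length_drop] at *
    omega
  · have := h.bot_sum
    simp only [List.sum_cons, List.length_append, List.length_reverse, List.length_take,
      List.length_drop] at *
    omega
  · rw [hlab, hlab]
    rcases Nat.lt_or_ge v y with hv | hv
    · rw [mirror_cons_lt A (by omega), if_neg (by omega), if_pos hv]
      congr 1; omega
    · obtain ⟨w, rfl⟩ := Nat.exists_eq_add_of_le' hv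
      by_cases hw : x ≤ w ∧ w < x + y
      · rw [hB w hw.1 hw.2, if_pos (by omega), if_neg (by omega)]
        congr 1; omega
      · rw [hrest w (by omega), if_neg (by omega), if_neg (by omega), Nat.add_sub_cancel,
          Nat.add_sub_cancel, h.label_top]
  · rw [hlab, hlab]
    rcases Nat.lt_or_ge v y with hv | hv
    · rw [mirror_cons_lt B hv, if_pos (by omega), if_pos hv]
      have := h.label_top (x + y - 1 - v)
      rw [hB' _ (by omega) (by omega)] at this
      rw [← this]
      congr 1; omega
    · obtain ⟨w, rfl⟩ := Nat.exists_eq_add_of_le' hv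
      rw [hbot, if_neg (by omega), if_neg (by omega), Nat.add_sub_cancel,
          Nat.add_sub_cancel, h.label_bot]
  · have key := h.connected (fun w => g (w + y)) (fun w => ?_) (fun w => ?_)
    · have hg : ∀ v, g v ↔ g ((if v < y then x + y - 1 - v else v - y) + y) := by
        intro v
        split_ifs with hv
        · rw [← h1 v, mirror_cons_lt A (by omega),
            show x + 2 * y - 1 - v = x + y - 1 - v + y by omega]
        · rw [Nat.sub_add_cancel (by omega)]
      intro u v hu huv
      rw [hlab, hlab] at huv
      rw [hg u, hg v]
      refine key _ _ ?_ huv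
      simp only [List.length_append, List.length_reverse, List.length_take,
        List.length_drop] at hu
      split_ifs <;> omega
    -- A top edge of the old block `y` becomes a top edge, a bottom edge and a top edge.
    · by_cases hw : x ≤ w ∧ w < x + y
      · have e1 := h1 (w + y)
        rw [hB w hw.1 hw.2] at e1
        have e2 := h2 (x + y - 1 - w)
        rw [mirror_cons_lt B (by omega)] at e2
        have e3 := h1 (y - 1 - (x + y - 1 - w))
        rw [mirror_cons_lt A (by omega)] at e3
        rw [hB' w hw.1 hw.2, ← e1, ← e2, ← e3]
        apply iff_of_eq
        congr 1; omega
      · rw [← hrest w (by omega)]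
        exact h1 _
    · rw [← hbot]
      exact h2 _
  · obtain ⟨d, d1, d2⟩ := h.graded
    -- A new vertex is the end of the top edge that starts in its mirror image.
    refine ⟨fun v => if v < y then d (x + y - 1 - v) - 1 else d (v - y), fun v hv => ?_,
      fun v hv => ?_⟩ <;> beta_reduce
    · rcases Nat.lt_or_ge v y with hvy | hvy
      · rw [mirror_cons_lt A (by omega), if_neg (by omega), if_pos hvy,
          show x + 2 * y - 1 - v - y = x + y - 1 - v by omega]
        ring
      · obtain ⟨w, rfl⟩ := Nat.exists_eq_add_of_le' hvy
        by_cases hw : x ≤ w ∧ w < x + y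
        · rw [hB w hw.1 hw.2] at hv
          omega
        · rw [hrest w (by omega)] at hv ⊢
          rw [if_neg (by omega), if_neg (by omega), Nat.add_sub_cancel, Nat.add_sub_cancel,
            d1 w (by omega)]
    · rcases Nat.lt_or_ge v y with hvy | hvy
      · rw [mirror_cons_lt B hvy] at hv ⊢
        rw [if_pos (by omega), if_pos hvy]
        have e := hB' (x + y - 1 - v) (by omega) (by omega)
        have := d1 (x + y - 1 - v) (by omega)
        rw [e] at this
        rw [show x + y - 1 - (y - 1 - v) = 2 * x + y - 1 - (x + y - 1 - v) by omega, this]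
        ring
      · obtain ⟨w, rfl⟩ := Nat.exists_eq_add_of_le' hvy
        rw [hbot] at hv ⊢
        rw [if_neg (by omega), if_neg (by omega), Nat.add_sub_cancel, Nat.add_sub_cancel,
          d2 w (by omega)]

theorem PathMeander.rot {x y : ℕ} {A B l : List ℕ} (hyx : y ≤ x)
    (h : PathMeander (x :: A) (y :: B) l) :
    PathMeander ((2 * x - y) :: A) (x :: B) ((l.take x).reverse ++ l.drop y) := by
  have hlen : x ≤ l.length := by
    have := h.top_sum; simp only [List.sum_cons] at this; omega
  have hlab : ∀ v : ℕ, ((l.take x).reverse ++ l.drop y)[v]? =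
      l[if v < x then x - 1 - v else v - (x - y)]? := by
    intro v
    have h1 : (l.take x).length = x := by simp; omega
    split_ifs with hv
    · rw [List.getElem?_append_left (by simp; omega), List.getElem?_reverse (by omega), h1,
        List.getElem?_take, if_pos (by omega)]
    · rw [List.getElem?_append_right (by simp; omega), List.length_reverse, h1,
        List.getElem?_drop]
      congr 1; omega
  have hbot : ∀ w, y ≤ w →
      mirror (x :: B) (w + (x - y)) = mirror (y :: B) w + (x - y) := by
    intro w hw
    rw [mirror_cons_ge B (by omega), mirror_cons_ge B hw, show w + (x - y) - x = w - y by omega]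
    omega
  have hbot' : ∀ w, y ≤ w → y ≤ mirror (y :: B) w := by
    intro w hw; rw [mirror_cons_ge B hw]; omega
  have htop : ∀ w, x ≤ w →
      mirror ((2 * x - y) :: A) (w + (x - y)) = mirror (x :: A) w + (x - y) := by
    intro w hw
    rw [mirror_cons_ge A (by omega), mirror_cons_ge A hw,
      show w + (x - y) - (2 * x - y) = w - x by omega]
    omega
  have htop' : ∀ w, x ≤ w → x ≤ mirror (x :: A) w := by
    intro w hw; rw [mirror_cons_ge A hw]; omega
  refine ⟨?_, ?_, fun v => ?_, fun v => ?_, fun g h1 h2 => ?_, ?_, h.rigid.rot hyx⟩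
  · have := h.top_sum
    simp only [List.sum_cons, List.length_append, List.length_reverse, List.length_take,
      List.length_drop] at *
    omega
  · have := h.bot_sum
    simp only [List.sum_cons, List.length_append, List.length_reverse, List.length_take,
      List.length_drop] at *
    omega
  · rw [hlab, hlab]
    rcases Nat.lt_or_ge v x with hv | hv
    · rw [mirror_cons_lt A (by omega), if_pos hv]
      split_ifs
      · rw [← h.label_bot (x - 1 - v), mirror_cons_lt B (by omega)]
        congr 1; omega
      · congr 1; omega
    · obtain ⟨w, rfl⟩ := Nat.exists_eq_add_of_le' (show x - y ≤ v by omega)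
      rcases Nat.lt_or_ge w x with hw | hw
      · rw [mirror_cons_lt A (by omega), if_pos (by omega), if_neg (by omega)]
        congr 1; omega
      · have := htop' w hw
        rw [htop w hw, if_neg (by omega), if_neg (by omega), Nat.add_sub_cancel,
          Nat.add_sub_cancel, h.label_top]
  · rw [hlab, hlab]
    rcases Nat.lt_or_ge v x with hv | hv
    · rw [mirror_cons_lt B hv, if_pos (by omega), if_pos hv, ← h.label_top (x - 1 - v),
        mirror_cons_lt A (by omega)]
    · obtain ⟨w, rfl⟩ := Nat.exists_eq_add_of_le' (show x - y ≤ v by omega)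
      have := hbot' w (by omega)
      rw [hbot w (by omega), if_neg (by omega), if_neg (by omega), Nat.add_sub_cancel,
          Nat.add_sub_cancel, h.label_bot]
  · have hg : ∀ w, w < x → y ≤ w → (g (x - 1 - w) ↔ g (w + (x - y))) := by
      intro w hw hw'
      rw [← h1 (x - 1 - w), mirror_cons_lt A (by omega)]
      apply iff_of_eq
      congr 1; omega
    -- `s` sends an old vertex to a new one: the first `x` go to their mirror images in the new
    -- first bottom block, the others are shifted.
    set s : ℕ → ℕ := fun w => if w < x then x - 1 - w else w + (x - y) with hs
    have hsge : ∀ w, y ≤ w → (g (s w) ↔ g (w + (x - y))) := by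
      intro w hw
      simp only [hs]
      split_ifs with hwx
      · exact hg w hwx hw
      · rfl
    have slt : ∀ w, w < x → s w = x - 1 - w := fun w hw => by simp [hs, hw]
    have key := h.connected (fun w => g (s w)) (fun w => ?_) (fun w => ?_)
    · have hg : ∀ v, g v ↔ g (s (if v < x then x - 1 - v else v - (x - y))) := by
        intro v
        split_ifs with hv
        · rw [slt _ (by omega)]
          apply iff_of_eq
          congr 1; omega
        · rw [hsge _ (by omega), Nat.sub_add_cancel (by omega)]
      intro u v hu huv
      rw [hlab, hlab] at huv
      rw [hg u, hg v]
      refine key _ _ ?_ huv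
      simp only [List.length_append, List.length_reverse, List.length_take,
        List.length_drop] at hu
      split_ifs <;> omega
    · rcases Nat.lt_or_ge w x with hw | hw
      · rw [mirror_cons_lt A hw, slt w hw, slt _ (by omega), ← h2 (x - 1 - w),
          mirror_cons_lt B (by omega)]
      · have := htop' w hw
        rw [hsge w (by omega), hsge _ (by omega), ← htop w hw]
        exact h1 _
    · rcases Nat.lt_or_ge w y with hw | hw
      · rw [mirror_cons_lt B hw, slt w (by omega), slt _ (by omega), ← h1 (x - 1 - w),
          mirror_cons_lt A (by omega)]
        apply iff_of_eq
        congr 1; omega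
      · have := hbot' w hw
        rw [hsge w hw, hsge _ this, ← hbot w hw]
        exact h2 _
  · obtain ⟨d, d1, d2⟩ := h.graded
    have e1 : ∀ v, v < x → x - 1 - v < v → d v = d (x - 1 - v) + 1 := by
      intro v hv hv'
      have := d1 (x - 1 - v)
      rw [mirror_cons_lt A (by omega), show x - 1 - (x - 1 - v) = v by omega] at this
      exact this hv'
    refine ⟨fun v => if v < x then d (x - 1 - v) else d (v - (x - y)) + 1, fun v hv => ?_,
      fun v hv => ?_⟩ <;> beta_reduce
    · rcases Nat.lt_or_ge v x with hvx | hvx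
      · rw [mirror_cons_lt A (by omega)] at hv ⊢
        rw [if_pos hvx]
        split_ifs
        · have := d2 (x - 1 - v)
          rw [mirror_cons_lt B (by omega), show y - 1 - (x - 1 - v) =
            x - 1 - (2 * x - y - 1 - v) by omega] at this
          exact this (by omega)
        · congr 2; omega
      · obtain ⟨w, rfl⟩ := Nat.exists_eq_add_of_le' (show x - y ≤ v by omega)
        rcases Nat.lt_or_ge w x with hw | hw
        · rw [mirror_cons_lt A (by omega)] at hv
          omega
        · have := htop' w hw
          rw [htop w hw] at hv ⊢
          rw [if_neg (by omega), if_neg (by omega), Nat.add_sub_cancel, Nat.add_sub_cancel,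
            d1 w (by omega)]
    · rcases Nat.lt_or_ge v x with hvx | hvx
      · rw [mirror_cons_lt B hvx] at hv ⊢
        rw [if_pos (by omega), if_pos hvx, show x - 1 - (x - 1 - v) = v by omega]
        exact e1 v hvx hv
      · obtain ⟨w, rfl⟩ := Nat.exists_eq_add_of_le' (show x - y ≤ v by omega)
        have := hbot' w (by omega)
        rw [hbot w (by omega)] at hv ⊢
        rw [if_neg (by omega), if_neg (by omega), Nat.add_sub_cancel, Nat.add_sub_cancel,
          d2 w (by omega)]

/-! ### Kernel equations in block form -/

/-- A finite directed graph `E` whose components are the fibres of `lab`, contained in a relation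
`S` which stands for the support of a space of matrices. It has a height function `d`, and the
kernel of the Kirillov form of `∑ e_{u,v}^*`, summed over the edges `u → v`, consists of diagonal
matrices. -/
structure PathSystem {V ι : Type*} [Fintype V] (S E : V → V → Prop) [DecidableRel E]
    (lab : V → ι) : Prop where
  refl : ∀ v, S v v
  edge_mem : ∀ u v, E u v → S u v
  edge_lab : ∀ u v, E u v → lab u = lab v
  lab_surj : Function.Surjective lab
  graded : ∃ d : V → ℤ, ∀ u v, E u v → d u = d v + 1
  connected : ∀ g : V → ℂ, (∀ u v, E u v → g u = g v) → ∀ u v, lab u = lab v → g u = g v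
  rigid : ∀ x : V → V → ℂ, (∀ u v, ¬ S u v → x u v = 0) →
    (∀ u v, S u v → (∑ w, if E w v then x w u else 0) = ∑ w, if E u w then x v w else 0) →
    ∀ u v, u ≠ v → x u v = 0

section

variable {V ι : Type*} [Fintype V] {S E : V → V → Prop} [DecidableRel E] {lab : V → ι}
  {c : ι → ℕ} {φ : ι → ℕ → ℕ → ℂ} {G : V → ℕ → V → ℕ → ℂ}

/-- The block matrix `G`, whose entry in row `(v, s)` and column `(u, t)` is `G v s u t`, is
supported on blocks in `S`, and offsets are smaller than the sizes `c` of the components. -/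
def BlockSupp (S : V → V → Prop) (lab : V → ι) (c : ι → ℕ) (G : V → ℕ → V → ℕ → ℂ) : Prop :=
  ∀ v s u t, ¬ (S v u ∧ s < c (lab v) ∧ t < c (lab u)) → G v s u t = 0

/-- The equations saying that `G` lies in the kernel of the Kirillov form of the functional with
coefficients `φ (lab v) s t` at the positions `((v, s), (v, t))` and `1` at the positions
`((u, s), (v, s))`, for the edges `u → v`. The equation for `u, v, s, t` tests against the matrix
unit at `((u, t), (v, s))`. -/
def BlockEq (S E : V → V → Prop) [DecidableRel E] (lab : V → ι) (c : ι → ℕ)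
    (φ : ι → ℕ → ℕ → ℂ) (G : V → ℕ → V → ℕ → ℂ) : Prop :=
  ∀ u v, S u v → ∀ s < c (lab v), ∀ t < c (lab u),
    (∑ r ∈ Finset.range (c (lab v)), φ (lab v) r s * G v r u t) +
        (∑ w, if E w v then G w s u t else 0) =
      (∑ r ∈ Finset.range (c (lab u)), φ (lab u) t r * G v s u r) +
        ∑ w, if E u w then G v s w t else 0

/-- If `φ = 0`, the solutions are block diagonal, with equal blocks along each component: for fixed
offsets this is the rigidity of scalar matrices, and the equations for the edges themselves compare
the diagonal blocks at their ends. -/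
theorem PathSystem.edge_rigid (h : PathSystem S E lab) (hG : BlockSupp S lab c G)
    (hE : ∀ u v, S u v → ∀ s < c (lab v), ∀ t < c (lab u),
      (∑ w, if E w v then G w s u t else 0) = ∑ w, if E u w then G v s w t else 0) :
    (∀ v s u t, v ≠ u → G v s u t = 0) ∧
      ∀ u v s t, lab u = lab v → G u s u t = G v s v t := by
  have hE' : ∀ s t u v, S u v →
      (∑ w, if E w v then G w s u t else 0) = ∑ w, if E u w then G v s w t else 0 := by
    intro s t u v huv
    by_cases hr : s < c (lab v) ∧ t < c (lab u)
    · exact hE u v huv s hr.1 t hr.2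
    · rw [Finset.sum_eq_zero, Finset.sum_eq_zero]
      · intro w _
        split_ifs with hw
        · refine hG _ _ _ _ fun h' => hr ⟨h'.2.1, ?_⟩
          rw [h.edge_lab u w hw]; exact h'.2.2
        · rfl
      · intro w _
        split_ifs with hw
        · refine hG _ _ _ _ fun h' => hr ⟨?_, h'.2.2⟩
          rw [← h.edge_lab w v hw]; exact h'.2.1
        · rfl
  have hdiag : ∀ v s u t, v ≠ u → G v s u t = 0 := fun v s u t hvu =>
    h.rigid (fun v u => G v s u t) (fun v u hvu => hG _ _ _ _ fun h' => hvu h'.1)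
      (hE' s t) v u hvu
  refine ⟨hdiag, fun u v s t => h.connected (fun u => G u s u t) (fun u v huv => ?_) u v⟩
  have := hE' s t u v (h.edge_mem u v huv)
  rwa [Finset.sum_eq_single u, Finset.sum_eq_single v, if_pos huv, if_pos huv] at this
  · intro w _ hw
    rw [hdiag v s w t hw.symm, ite_self]
  · simp
  · intro w _ hw
    rw [hdiag w s u t hw, ite_self]
  · simp

/-- Let the block in row `v` and column `u` have degree `d v - d u`. If a solution has no part of
degree below `k`, then its part of degree `k` solves the equations with `φ = 0`, because the core
terms accompanying edge terms of degree `k` have degree `k - 1`. So the conclusions of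
`PathSystem.edge_rigid` hold for it. -/
theorem PathSystem.lowest (h : PathSystem S E lab) {d : V → ℤ}
    (hd : ∀ u v, E u v → d u = d v + 1) (hG : BlockSupp S lab c G)
    (hK : BlockEq S E lab c φ G) (k : ℤ) (hk : ∀ v s u t, d v - d u < k → G v s u t = 0) :
    (∀ v s u t, v ≠ u → d v - d u = k → G v s u t = 0) ∧
      (k = 0 → ∀ u v s t, lab u = lab v → G u s u t = G v s v t) := by
  have key := h.edge_rigid (c := c)
    (G := fun v s u t => if d v - d u = k then G v s u t else 0) ?_ ?_
  · refine ⟨fun v s u t hvu hdeg => ?_, fun hk u v s t huv => ?_⟩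
    · simpa [hdeg] using key.1 v s u t hvu
    · simpa [hk] using key.2 u v s t huv
  · intro v s u t hn
    simp [hG v s u t hn]
  · intro u v huv s hs t ht
    by_cases hdeg : d u - d v = 1 - k
    · have := hK u v huv s hs t ht
      have z1 : ∑ r ∈ Finset.range (c (lab v)), φ (lab v) r s * G v r u t = 0 :=
        Finset.sum_eq_zero fun r _ => by rw [hk v r u t (by omega), mul_zero]
      have z2 : ∑ r ∈ Finset.range (c (lab u)), φ (lab u) t r * G v s u r = 0 :=
        Finset.sum_eq_zero fun r _ => by rw [hk v s u r (by omega), mul_zero]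
      rw [z1, z2, zero_add, zero_add] at this
      convert this using 2 with w _ w _
      · refine if_ctx_congr Iff.rfl (fun hw => ?_) (fun _ => rfl)
        have := hd w v hw
        rw [if_pos (by omega)]
      · refine if_ctx_congr Iff.rfl (fun hw => ?_) (fun _ => rfl)
        have := hd u w hw
        rw [if_pos (by omega)]
    · rw [Finset.sum_eq_zero, Finset.sum_eq_zero]
      · intro w _
        split_ifs with hw hw'
        · have := hd u w hw; omega
        · rfl
        · rfl
      · intro w _
        split_ifs with hw hw'
        · have := hd w v hw; omega
        · rfl
        · rfl

/-- A solution has no part of negative degree, and if its part of degree zero vanishes, it is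
zero. -/
theorem PathSystem.vanish (h : PathSystem S E lab) {d : V → ℤ}
    (hd : ∀ u v, E u v → d u = d v + 1) (hG : BlockSupp S lab c G)
    (hK : BlockEq S E lab c φ G) (K : ℤ)
    (h0 : K ≤ 0 ∨ ∀ v s u t, d v = d u → G v s u t = 0) :
    ∀ v s u t, d v - d u < K → G v s u t = 0 := by
  obtain ⟨B, hB⟩ : ∃ B : ℕ, ∀ v, |d v| ≤ B := by
    refine ⟨∑ v, (d v).natAbs, fun v => ?_⟩
    rw [Int.abs_eq_natAbs]
    exact_mod_cast Finset.single_le_sum (f := fun v => (d v).natAbs) (fun _ _ => Nat.zero_le _)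
      (Finset.mem_univ v)
  -- All degrees are at least `-2 * B`, where the induction over the degree starts.
  have key : ∀ N : ℕ, (N : ℤ) - 2 * B ≤ K →
      ∀ v s u t, d v - d u < (N : ℤ) - 2 * B → G v s u t = 0 := by
    intro N
    induction N with
    | zero =>
      intro _ v s u t hlt
      have h1 := abs_le.1 (hB v)
      have h2 := abs_le.1 (hB u)
      push_cast at hlt
      omega
    | succ N ih =>
      intro hN v s u t hlt
      push_cast at hN hlt
      have ih := ih (by omega)
      rcases (show d v - d u < (N : ℤ) - 2 * B ∨ d v - d u = (N : ℤ) - 2 * B by omega)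
        with h1 | h1
      · exact ih v s u t h1
      · by_cases hvu : v = u
        · subst hvu
          rcases h0 with h0 | h0
          · omega
          · exact h0 v s v t rfl
        · exact (h.lowest hd hG hK _ ih).1 v s u t hvu h1
  intro v s u t hlt
  rcases le_or_gt K (-2 * B) with hKB | hKB
  · have h1 := abs_le.1 (hB v)
    have h2 := abs_le.1 (hB u)
    omega
  · exact key (K + 2 * B).toNat (by omega) v s u t (by omega)

/-- Summed over a component, the terms for incoming edges and those for outgoing edges agree. -/
theorem PathSystem.edge_sum [DecidableEq ι] (h : PathSystem S E lab) (i : ι)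
    (g : V → V → ℂ) :
    (∑ v with lab v = i, ∑ w, if E w v then g w v else 0) =
      ∑ v with lab v = i, ∑ w, if E v w then g v w else 0 := by
  simp only [Finset.sum_filter]
  have h1 : ∀ v, (if lab v = i then ∑ w, (if E w v then g w v else 0) else 0) =
      ∑ w, if E w v ∧ lab v = i then g w v else 0 := by
    intro v
    split_ifs with hv <;> simp [hv]
  have h2 : ∀ v, (if lab v = i then ∑ w, (if E v w then g v w else 0) else 0) =
      ∑ w, if E v w ∧ lab w = i then g v w else 0 := by
    intro v
    split_ifs with hv
    · refine Finset.sum_congr rfl fun w _ => ?_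
      refine if_congr ⟨fun hw => ⟨hw, ?_⟩, fun hw => hw.1⟩ rfl rfl
      rw [← h.edge_lab v w hw, hv]
    · symm
      refine Finset.sum_eq_zero fun w _ => if_neg fun hw => hv ?_
      rw [h.edge_lab v w hw.1, hw.2]
  simp only [h1, h2]
  exact Finset.sum_comm

/-- The block diagonal matrix with the matrix `Z (lab v)` as the block of `v`. -/
def blockDiag [DecidableEq V] (lab : V → ι) (Z : ι → ℕ → ℕ → ℂ) (v : V) (s : ℕ) (u : V) (t : ℕ) :
    ℂ := if v = u then Z (lab v) s t else 0

theorem PathSystem.blockEq_blockDiag [DecidableEq V] (h : PathSystem S E lab)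
    {Z : ι → ℕ → ℕ → ℂ}
    (hZ : ∀ i, ∀ s < c i, ∀ t < c i, ∑ r ∈ Finset.range (c i), φ i r s * Z i r t =
      ∑ r ∈ Finset.range (c i), φ i t r * Z i s r) :
    BlockEq S E lab c φ (blockDiag lab Z) := by
  intro u v huv s hs t ht
  have e1 : (∑ w, if E w v then blockDiag lab Z w s u t else 0) =
      if E u v then Z (lab u) s t else 0 := by
    rw [Finset.sum_eq_single u]
    · simp [blockDiag]
    · intro w _ hw; simp [blockDiag, hw]
    · simp
  have e2 : (∑ w, if E u w then blockDiag lab Z v s w t else 0) =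
      if E u v then Z (lab u) s t else 0 := by
    rw [Finset.sum_eq_single v]
    · refine if_ctx_congr Iff.rfl (fun hw => ?_) (fun _ => rfl)
      simp [blockDiag, h.edge_lab u v hw]
    · intro w _ hw; simp [blockDiag, hw.symm]
    · simp
  rw [e1, e2]
  congr 1
  by_cases hvu : v = u
  · subst hvu
    simpa [blockDiag] using hZ (lab v) s hs t ht
  · simp [blockDiag, hvu]

/-- Every solution is block diagonal, with blocks that are constant along the components and, for
each component `i`, lie in the kernel of the Kirillov form with coefficients `φ i`. -/
theorem PathSystem.exists_blockDiag [DecidableEq V] [DecidableEq ι] (h : PathSystem S E lab)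
    (hG : BlockSupp S lab c G) (hK : BlockEq S E lab c φ G) :
    ∃ Z : ι → ℕ → ℕ → ℂ, G = blockDiag lab Z ∧
      ∀ i, ∀ s < c i, ∀ t < c i, ∑ r ∈ Finset.range (c i), φ i r s * Z i r t =
        ∑ r ∈ Finset.range (c i), φ i t r * Z i s r := by
  obtain ⟨d, hd⟩ := h.graded
  have hneg := h.vanish hd hG hK 0 (Or.inl le_rfl)
  obtain ⟨hoff, hconst⟩ := h.lowest hd hG hK 0 hneg
  choose σ hσ using h.lab_surj
  set Z : ι → ℕ → ℕ → ℂ := fun i s t => G (σ i) s (σ i) t with hZdef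
  have hGZ : ∀ v s t, G v s v t = Z (lab v) s t := fun v s t =>
    hconst rfl v _ s t (hσ _).symm
  have hZ : ∀ i, ∀ s < c i, ∀ t < c i, ∑ r ∈ Finset.range (c i), φ i r s * Z i r t =
        ∑ r ∈ Finset.range (c i), φ i t r * Z i s r := by
    intro i s hs t ht
    -- In the sum of the diagonal equations over the component, the edge terms cancel.
    have hsum : ∀ v ∈ Finset.univ.filter (fun v => lab v = i),
        (∑ r ∈ Finset.range (c i), φ i r s * Z i r t) +
          (∑ w, if E w v then G w s v t else 0) =
        (∑ r ∈ Finset.range (c i), φ i t r * Z i s r) +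
          ∑ w, if E v w then G v s w t else 0 := by
      intro v hv
      have hv : lab v = i := by simpa using hv
      have := hK v v (h.refl v) s (by rwa [hv]) t (by rwa [hv])
      simpa only [hGZ, hv] using this
    have := Finset.sum_congr rfl hsum
    rw [Finset.sum_add_distrib, Finset.sum_add_distrib,
      h.edge_sum i (fun w v => G w s v t), add_left_inj, Finset.sum_const, Finset.sum_const] at this
    rw [nsmul_eq_mul, nsmul_eq_mul] at this
    refine mul_left_cancel₀ ?_ this
    rw [Nat.cast_ne_zero, Finset.card_ne_zero]
    exact ⟨σ i, by simp [hσ]⟩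
  refine ⟨Z, ?_, hZ⟩
  -- The difference from the block diagonal solution has no part of degree zero, hence vanishes.
  have hG' : BlockSupp S lab c (fun v s u t => G v s u t - blockDiag lab Z v s u t) := by
    intro v s u t hn
    beta_reduce
    rw [hG v s u t hn, blockDiag]
    split_ifs with hvu
    · subst hvu
      rw [← hGZ, hG v s v t hn, sub_zero]
    · simp
  have hK' : BlockEq S E lab c φ (fun v s u t => G v s u t - blockDiag lab Z v s u t) := by
    intro u v huv s hs t ht
    have e1 := hK u v huv s hs t ht
    have e2 := h.blockEq_blockDiag hZ u v huv s hs t ht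
    have e3 : ∀ (P : V → Prop) [DecidablePred P] (f g : V → ℂ),
        (∑ w, if P w then f w - g w else 0) =
          (∑ w, if P w then f w else 0) - ∑ w, if P w then g w else 0 := by
      intro P _ f g
      rw [← Finset.sum_sub_distrib]
      refine Finset.sum_congr rfl fun w _ => ?_
      split_ifs <;> simp
    simp only [mul_sub, Finset.sum_sub_distrib, e3]
    linear_combination e1 - e2
  funext v s u t
  have := h.vanish hd hG' hK' (d v - d u + 1) (Or.inr ?_) v s u t (by omega)
  · exact sub_eq_zero.1 this
  · intro v s u t hvu
    unfold blockDiag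
    split_ifs with h'
    · subst h'
      rw [hGZ, sub_self]
    · rw [hoff v s u t h' (by omega), sub_zero]

end

/-! ### The kernel of the Kirillov form of a block functional -/

/-- The value of a functional at the bracket of a matrix with a matrix unit. -/
theorem map_lie_single {I : Type*} [Fintype I] [DecidableEq I]
    (f : Module.Dual ℂ (Matrix I I ℂ)) (X : Matrix I I ℂ) (u v : I) :
    f ⁅X, Matrix.single u v 1⁆ = ∑ p, f (Matrix.single p v 1) * X p u -
      ∑ q, f (Matrix.single u q 1) * X v q := by
  have h1 : X * Matrix.single u v 1 = ∑ p, X p u • Matrix.single p v (1 : ℂ) := by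
    ext i j
    rw [Matrix.sum_apply]
    simp only [Matrix.smul_apply, Matrix.single_apply, smul_eq_mul, Matrix.mul_apply]
    by_cases hj : v = j
    · simp [hj]
    · simp [hj]
  have h2 : Matrix.single u v 1 * X = ∑ q, X v q • Matrix.single u q (1 : ℂ) := by
    ext i j
    rw [Matrix.sum_apply]
    simp only [Matrix.smul_apply, Matrix.single_apply, smul_eq_mul, Matrix.mul_apply]
    by_cases hj : u = i
    · simp [hj]
    · simp [hj]
  rw [Ring.lie_def, h1, h2, map_sub, map_sum, map_sum]
  simp only [map_smul, smul_eq_mul, mul_comm]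

theorem map_lie {I : Type*} [Fintype I] [DecidableEq I]
    (f : Module.Dual ℂ (Matrix I I ℂ)) (X Y : Matrix I I ℂ) :
    f ⁅X, Y⁆ = ∑ u, ∑ v, Y u v * (∑ p, f (Matrix.single p v 1) * X p u -
      ∑ q, f (Matrix.single u q 1) * X v q) := by
  have hY : Y = ∑ u, ∑ v, Y u v • Matrix.single u v (1 : ℂ) := by
    conv_lhs => rw [Matrix.matrix_eq_sum_single Y]
    simp
  have : ∀ s : Finset I, ∀ g : I → Matrix I I ℂ, ⁅X, ∑ u ∈ s, g u⁆ = ∑ u ∈ s, ⁅X, g u⁆ :=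
    fun s g => lie_sum _ _ _
  conv_lhs => rw [hY]
  simp only [this, lie_smul, map_sum, map_smul, map_lie_single, smul_eq_mul]

theorem mem_ker_kirillovForm_matrix {I : Type*} [Fintype I] [DecidableEq I]
    (f : Module.Dual ℂ (Matrix I I ℂ)) (X : Matrix I I ℂ) :
    X ∈ LinearMap.ker (kirillovForm f) ↔ ∀ u v,
      ∑ p, f (Matrix.single p v 1) * X p u = ∑ q, f (Matrix.single u q 1) * X v q := by
  have hap : ∀ Y : Matrix I I ℂ, kirillovForm f X Y = f ⁅X, Y⁆ := fun Y => rfl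
  rw [LinearMap.mem_ker]
  constructor
  · intro h u v
    rw [← sub_eq_zero, ← map_lie_single, ← hap, h]
    rfl
  · intro h
    refine LinearMap.ext fun Y => ?_
    rw [hap, map_lie, LinearMap.zero_apply]
    exact Finset.sum_eq_zero fun u _ => Finset.sum_eq_zero fun v _ => by
      rw [h u v, sub_self, mul_zero]

/-- For a subalgebra that consists of the matrices supported on `R`, it suffices to test against the
matrix units in `R`. -/
theorem mem_ker_kirillovForm_subalgebra {I : Type*} [Fintype I] [DecidableEq I]
    (L : LieSubalgebra ℂ (Matrix I I ℂ)) {R : I → I → Prop}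
    (hL : ∀ X, X ∈ L ↔ ∀ p q, ¬ R p q → X p q = 0)
    (f : Module.Dual ℂ (Matrix I I ℂ)) (X : L) :
    X ∈ LinearMap.ker (kirillovForm (L := L) (f ∘ₗ L.toSubmodule.subtype)) ↔ ∀ u v, R u v →
      ∑ p, f (Matrix.single p v 1) * X.1 p u = ∑ q, f (Matrix.single u q 1) * X.1 v q := by
  have hmem : ∀ u v, R u v → Matrix.single u v (1 : ℂ) ∈ L := by
    intro u v huv
    rw [hL]
    intro p q hpq
    rw [Matrix.single_apply, if_neg]
    rintro ⟨rfl, rfl⟩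
    exact hpq huv
  have hap : ∀ Y : L, kirillovForm (L := L) (f ∘ₗ L.toSubmodule.subtype) X Y = f ⁅X.1, Y.1⁆ :=
    fun Y => rfl
  rw [LinearMap.mem_ker]
  constructor
  · intro h u v huv
    rw [← sub_eq_zero, ← map_lie_single, ← hap ⟨_, hmem u v huv⟩, h]
    rfl
  · intro h
    refine LinearMap.ext fun Y => ?_
    rw [hap, map_lie, LinearMap.zero_apply]
    refine Finset.sum_eq_zero fun u _ => Finset.sum_eq_zero fun v _ => ?_
    by_cases huv : R u v
    · rw [h u v huv, sub_self, mul_zero]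
    · rw [(hL Y.1).1 Y.2 u v huv, zero_mul]

section

variable {V ι I : Type*} {lab : V → ι} {c : ι → ℕ}

/-- The coefficient `γ_{s,t}` of `F = ∑ γ_{s,t} e_{s,t}^*`, extended by zero to all natural
numbers. -/
def coeff {k : ℕ} (F : Module.Dual ℂ (Matrix (Fin k) (Fin k) ℂ)) (s t : ℕ) : ℂ :=
  if h : s < k ∧ t < k then F (Matrix.single ⟨s, h.1⟩ ⟨t, h.2⟩ 1) else 0

/-- The entries of a matrix, extended by zero to all natural numbers. -/
def extendZero {k : ℕ} (Z : Matrix (Fin k) (Fin k) ℂ) (s t : ℕ) : ℂ :=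
  if h : s < k ∧ t < k then Z ⟨s, h.1⟩ ⟨t, h.2⟩ else 0

/-- The entries of a matrix in terms of vertices and offsets, where `e` assigns to an index its
vertex and its offset; zero if an offset is out of range. -/
def blockEntry (e : I ≃ Σ v, Fin (c (lab v))) (X : Matrix I I ℂ) (v : V) (s : ℕ) (u : V) (t : ℕ) :
    ℂ :=
  if h : s < c (lab v) ∧ t < c (lab u) then X (e.symm ⟨v, s, h.1⟩) (e.symm ⟨u, t, h.2⟩) else 0

theorem blockEntry_apply (e : I ≃ Σ v, Fin (c (lab v))) (X : Matrix I I ℂ) (p q : I) :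
    blockEntry e X (e p).1 (e p).2 (e q).1 (e q).2 = X p q := by
  simp [blockEntry]

theorem val_apply_symm (e : I ≃ Σ v, Fin (c (lab v))) (x : Σ v, Fin (c (lab v))) :
    ((e (e.symm x)).2 : ℕ) = x.2 := by
  rw [Equiv.apply_symm_apply]

theorem sum_block [Fintype V] [DecidableEq V] [Fintype I] (e : I ≃ Σ v, Fin (c (lab v)))
    (φ : ℕ → ℂ) (v : V) (f : I → ℂ) (g : V → ℕ → ℂ) (hg : ∀ p, f p = g (e p).1 (e p).2) :
    ∑ p, (if (e p).1 = v then φ (e p).2 else 0) * f p =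
      ∑ r ∈ Finset.range (c (lab v)), φ r * g v r := by
  rw [← e.symm.sum_comp, Fintype.sum_sigma, Finset.sum_eq_single v]
  · simp [hg, Finset.sum_range, val_apply_symm]
  · intro w _ hw
    simp [hw]
  · simp

theorem sum_edge [Fintype V] [Fintype I] (e : I ≃ Σ v, Fin (c (lab v))) (P : V → Prop)
    [DecidablePred P] (s : ℕ) (f : I → ℂ) (g : V → ℕ → ℂ) (hg : ∀ p, f p = g (e p).1 (e p).2)
    (hs : ∀ w, P w → s < c (lab w)) :
    ∑ p, (if P (e p).1 ∧ ((e p).2 : ℕ) = s then 1 else 0) * f p =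
      ∑ w, if P w then g w s else 0 := by
  rw [← e.symm.sum_comp, Fintype.sum_sigma]
  refine Finset.sum_congr rfl fun w _ => ?_
  by_cases hw : P w
  · rw [Finset.sum_eq_single ⟨s, hs w hw⟩]
    · simp [hg, hw, val_apply_symm]
    · intro r _ hr
      have : (r : ℕ) ≠ s := fun h => hr (Fin.ext h)
      simp [this, val_apply_symm]
    · simp
  · simp [hw]

/-- The matrices supported on `S` (in terms of the vertices of the indices), with the functional
that has a copy of `F (lab v)` in the diagonal block of each vertex `v` and the main diagonal in
the block of each edge, have a Kirillov kernel isomorphic to the product of the kernels for the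
`F i`. -/
theorem dimKer_eq_sum [Fintype V] [DecidableEq V] {S E : V → V → Prop} [DecidableRel E]
    [Fintype ι] [DecidableEq ι] [Fintype I] [DecidableEq I]
    (hP : PathSystem S E lab) (e : I ≃ Σ v, Fin (c (lab v)))
    (L : LieSubalgebra ℂ (Matrix I I ℂ))
    (hL : ∀ X, X ∈ L ↔ ∀ p q, ¬ S (e p).1 (e q).1 → X p q = 0)
    (F : ∀ i, Module.Dual ℂ (Matrix (Fin (c i)) (Fin (c i)) ℂ))
    (f : Module.Dual ℂ (Matrix I I ℂ))
    (hf : ∀ p q, f (Matrix.single p q 1) =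
      (if (e p).1 = (e q).1 then coeff (F (lab (e p).1)) (e p).2 (e q).2 else 0) +
        if E (e p).1 (e q).1 ∧ ((e p).2 : ℕ) = (e q).2 then 1 else 0) :
    dimKer (L := L) (f ∘ₗ L.toSubmodule.subtype) = ∑ i, dimKer (F i) := by
  -- Coefficient functions on `ℕ` have a type that does not depend on the vertex, so that vertices
  -- can be rewritten in them.
  obtain ⟨φ, hφ⟩ : ∃ φ : ι → ℕ → ℕ → ℂ, ∀ i s t, coeff (F i) s t = φ i s t :=
    ⟨fun i => coeff (F i), fun _ _ _ => rfl⟩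
  simp only [hφ] at hf
  have hK : ∀ X : Matrix I I ℂ, (∀ u v, S (e u).1 (e v).1 →
      ∑ p, f (Matrix.single p v 1) * X p u = ∑ q, f (Matrix.single u q 1) * X v q) ↔
      BlockEq S E lab c φ (blockEntry e X) := by
    have key : ∀ (X : Matrix I I ℂ) (u v : I),
        (∑ p, f (Matrix.single p v 1) * X p u = ∑ q, f (Matrix.single u q 1) * X v q) ↔
        ((∑ r ∈ Finset.range (c (lab (e v).1)), φ (lab (e v).1) r (e v).2 *
            blockEntry e X (e v).1 r (e u).1 (e u).2) +
          (∑ w, if E w (e v).1 then blockEntry e X w (e v).2 (e u).1 (e u).2 else 0) =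
        (∑ r ∈ Finset.range (c (lab (e u).1)), φ (lab (e u).1) (e u).2 r *
            blockEntry e X (e v).1 (e v).2 (e u).1 r) +
          ∑ w, if E (e u).1 w then blockEntry e X (e v).1 (e v).2 w (e u).2 else 0) := by
      intro X u v
      rw [← sum_block e (fun r => φ (lab (e v).1) r (e v).2) (e v).1 (fun p => X p u)
          (fun w r => blockEntry e X w r (e u).1 (e u).2)
          (fun p => (blockEntry_apply e X p u).symm),
        ← sum_block e (fun r => φ (lab (e u).1) (e u).2 r) (e u).1 (fun q => X v q)
          (fun w r => blockEntry e X (e v).1 (e v).2 w r)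
          (fun q => (blockEntry_apply e X v q).symm),
        ← sum_edge e (fun w => E w (e v).1) (e v).2 (fun p => X p u)
          (fun w r => blockEntry e X w r (e u).1 (e u).2)
          (fun p => (blockEntry_apply e X p u).symm)
          (fun w hw => by rw [hP.edge_lab _ _ hw]; exact (e v).2.2),
        ← sum_edge e (fun w => E (e u).1 w) (e u).2 (fun q => X v q)
          (fun w r => blockEntry e X (e v).1 (e v).2 w r)
          (fun q => (blockEntry_apply e X v q).symm)
          (fun w hw => by rw [← hP.edge_lab _ _ hw]; exact (e u).2.2),
        ← Finset.sum_add_distrib, ← Finset.sum_add_distrib]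
      apply iff_of_eq
      congr 1
      · refine Finset.sum_congr rfl fun p _ => ?_
        rw [hf, add_mul]
        congr 2
        refine if_ctx_congr Iff.rfl (fun h => congrArg (fun i => φ i _ _) (congrArg lab h))
          (fun _ => rfl)
      · refine Finset.sum_congr rfl fun q _ => ?_
        rw [hf, add_mul]
        congr 2
        · exact if_congr eq_comm rfl rfl
        · exact if_congr (and_congr Iff.rfl eq_comm) rfl rfl
    intro X
    constructor
    · intro h u v huv s hs t ht
      have := (key X (e.symm ⟨u, t, ht⟩) (e.symm ⟨v, s, hs⟩)).1 (h _ _ (by simpa using huv))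
      simpa [val_apply_symm] using this
    · intro h u v huv
      exact (key X u v).2 (h _ _ huv _ (e v).2.2 _ (e u).2.2)
  have hG : ∀ X ∈ L, BlockSupp S lab c (blockEntry e X) := by
    intro X hX v s u t hn
    unfold blockEntry
    split_ifs with h
    · exact (hL X).1 hX _ _ (by simpa [h] using hn)
    · rfl
  have hZ : ∀ i (Z : Matrix (Fin (c i)) (Fin (c i)) ℂ),
      Z ∈ LinearMap.ker (kirillovForm (F i)) ↔ ∀ s < c i, ∀ t < c i,
        ∑ r ∈ Finset.range (c i), φ i r s * extendZero Z r t =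
          ∑ r ∈ Finset.range (c i), φ i t r * extendZero Z s r := by
    intro i Z
    rw [mem_ker_kirillovForm_matrix]
    constructor
    · intro h s hs t ht
      have := h ⟨t, ht⟩ ⟨s, hs⟩
      simpa [Finset.sum_range, ← hφ, coeff, extendZero, hs, ht] using this
    · intro h u v
      have := h v v.2 u u.2
      simpa [Finset.sum_range, ← hφ, coeff, extendZero] using this
  -- `Ψ` puts together the block diagonal matrix with the given blocks.
  let Ψ : (∀ i, Matrix (Fin (c i)) (Fin (c i)) ℂ) →ₗ[ℂ] Matrix I I ℂ :=
    { toFun := fun Z p q =>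
        blockDiag lab (fun i => extendZero (Z i)) (e p).1 (e p).2 (e q).1 (e q).2
      map_add' := by
        intro Z Z'
        ext p q
        change blockDiag _ _ _ _ _ _ = blockDiag _ _ _ _ _ _ + blockDiag _ _ _ _ _ _
        simp only [blockDiag, extendZero]
        split_ifs <;> simp
      map_smul' := by
        intro r Z
        ext p q
        change blockDiag _ _ _ _ _ _ = r * blockDiag _ _ _ _ _ _
        simp only [blockDiag, extendZero]
        split_ifs <;> simp }
  have hΨ : ∀ Z p q, Ψ Z p q =
    blockDiag lab (fun i => extendZero (Z i)) (e p).1 (e p).2 (e q).1 (e q).2 := fun _ _ _ => rfl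
  have hΨs : ∀ Z v s u t, Ψ Z (e.symm ⟨v, s⟩) (e.symm ⟨u, t⟩) =
      blockDiag lab (fun i => extendZero (Z i)) v s u t := by
    intro Z v s u t
    rw [hΨ, Equiv.apply_symm_apply, Equiv.apply_symm_apply]
  have hΨinj : Function.Injective Ψ := by
    intro Z Z' h
    funext i
    obtain ⟨v, rfl⟩ := hP.lab_surj i
    ext s t
    have := congrFun (congrFun h (e.symm ⟨v, s⟩)) (e.symm ⟨v, t⟩)
    simpa [hΨs, blockDiag, extendZero] using this
  have hΨe : ∀ Z, blockEntry e (Ψ Z) = blockDiag lab (fun i => extendZero (Z i)) := by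
    intro Z
    funext v s u t
    simp only [blockEntry, hΨs, blockDiag]
    by_cases hvu : v = u
    · subst hvu
      simp only [if_true, extendZero]
      split_ifs <;> rfl
    · simp [hvu]
  have hΨL : ∀ Z, Ψ Z ∈ L := by
    intro Z
    rw [hL]
    intro p q hpq
    rw [hΨ, blockDiag, if_neg]
    intro h
    exact hpq (h ▸ hP.refl _)
  let Φ : (∀ i, LinearMap.ker (kirillovForm (F i))) →ₗ[ℂ] Matrix I I ℂ :=
    Ψ ∘ₗ LinearMap.pi fun i => (LinearMap.ker (kirillovForm (F i))).subtype ∘ₗ LinearMap.proj i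
  have hΦ : ∀ Z, Φ Z = Ψ fun i => (Z i).1 := fun _ => rfl
  have hΦinj : Function.Injective Φ := by
    intro Z Z' h
    have := hΨinj h
    funext i
    exact Subtype.ext (congrFun this i)
  let inc : L →ₗ[ℂ] Matrix I I ℂ := L.toSubmodule.subtype
  have hrange : LinearMap.range Φ =
      (LinearMap.ker (kirillovForm (L := L) (f ∘ₗ L.toSubmodule.subtype))).map inc := by
    ext X
    rw [LinearMap.mem_range, Submodule.mem_map]
    constructor
    · rintro ⟨Z, rfl⟩
      refine ⟨⟨Φ Z, hΨL _⟩, ?_, rfl⟩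
      rw [mem_ker_kirillovForm_subalgebra L hL]
      refine (hK _).2 ?_
      change BlockEq S E lab c φ (blockEntry e (Ψ fun i => (Z i).1))
      rw [hΨe]
      exact hP.blockEq_blockDiag fun i => (hZ i _).1 (Z i).2
    · rintro ⟨X, hX, rfl⟩
      rw [mem_ker_kirillovForm_subalgebra L hL] at hX
      obtain ⟨Z, hZ1, hZ2⟩ := hP.exists_blockDiag (hG X.1 X.2) ((hK _).1 hX)
      have hZext : ∀ i, extendZero (Matrix.of fun s t : Fin (c i) => Z i s t) = Z i := by
        intro i
        obtain ⟨v, rfl⟩ := hP.lab_surj i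
        funext s t
        unfold extendZero
        split_ifs with hst
        · rfl
        · have := congrFun (congrFun (congrFun (congrFun hZ1 v) s) v) t
          rw [hG X.1 X.2 v s v t fun h => hst h.2, blockDiag, if_pos rfl] at this
          exact this
      refine ⟨fun i => ⟨Matrix.of fun s t => Z i s t, ?_⟩, ?_⟩
      · rw [hZ, hZext]
        exact hZ2 i
      · ext p q
        rw [hΦ, hΨ]
        simp only [hZext]
        change _ = X.1 p q
        rw [← blockEntry_apply e X.1 p q, hZ1]
  have h1 : Module.finrank ℂ (LinearMap.range Φ) = ∑ i, dimKer (F i) := by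
    rw [LinearMap.finrank_range_of_inj hΦinj, Module.finrank_pi_fintype]
    rfl
  rw [← h1, hrange, dimKer]
  exact (Submodule.equivMapOfInjective inc Subtype.val_injective _).finrank_eq

end

/-! ### Replacing the vertices of a meander by intervals -/

/-- The sizes of the blocks if the vertices of a meander with blocks of the given sizes are replaced
by intervals, where the second list gives the lengths of the intervals. -/
def blockSums : List ℕ → List ℕ → List ℕ
  | [], _ => []
  | k :: ks, W => (W.take k).sum :: blockSums ks (W.drop k)

/-- The sizes of the components to which the vertices of a meander belong. -/
def weights (cs label : List ℕ) : List ℕ := label.map fun i => cs.getD i 0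

/-- `M` is a union of labelled paths, and it becomes the meander of type `as / bs` when every vertex
with label `i` is replaced by an interval of length `cs i`. -/
structure Expands (as bs cs : List ℕ) (M : LabelledMeander) : Prop where
  path : PathMeander M.top M.bot M.label
  label_lt : ∀ i ∈ M.label, i < cs.length
  top_eq : blockSums M.top (weights cs M.label) = as
  bot_eq : blockSums M.bot (weights cs M.label) = bs

theorem length_weights (cs label : List ℕ) : (weights cs label).length = label.length := by
  simp [weights]

theorem weights_append (cs l l' : List ℕ) :
    weights cs (l ++ l') = weights cs l ++ weights cs l' := by simp [weights]

theorem weights_reverse (cs l : List ℕ) : weights cs l.reverse = (weights cs l).reverse := by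
  simp [weights]

theorem weights_take (cs l : List ℕ) (k : ℕ) : weights cs (l.take k) = (weights cs l).take k := by
  simp [weights]

theorem weights_drop (cs l : List ℕ) (k : ℕ) : weights cs (l.drop k) = (weights cs l).drop k := by
  simp [weights]

theorem Expands.nil : Expands [] [] [] ⟨[], [], []⟩ :=
  ⟨PathMeander.nil, by simp, rfl, rfl⟩

theorem Expands.flip {as bs cs : List ℕ} {M : LabelledMeander} (h : Expands as bs cs M) :
    Expands bs as cs ⟨M.bot, M.top, M.label⟩ :=
  ⟨h.path.flip, h.label_lt, h.bot_eq, h.top_eq⟩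

theorem Expands.comp {as bs cs : List ℕ} {M : LabelledMeander} (h : Expands as bs cs M) (c : ℕ) :
    Expands (c :: as) (c :: bs) (c :: cs)
      ⟨1 :: M.top, 1 :: M.bot, List.replicate 1 0 ++ M.label.map Nat.succ⟩ := by
  have hw : weights (c :: cs) (0 :: M.label.map Nat.succ) = c :: weights cs M.label := by
    simp [weights]
  refine ⟨by simpa using h.path.unit, ?_, ?_, ?_⟩
  · simpa using h.label_lt
  · simpa [hw, blockSums] using h.top_eq
  · simpa [hw, blockSums] using h.bot_eq

theorem Expands.pure {α β : ℕ} {as bs cs : List ℕ} {x y : ℕ} {A B l : List ℕ}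
    (h : Expands (α :: β :: as) bs cs ⟨x :: y :: A, B, l⟩) :
    Expands ((α + 2 * β) :: as) (β :: bs) cs
      ⟨(x + 2 * y) :: A, y :: B, ((l.drop x).take y).reverse ++ l⟩ := by
  have hlen : x + y ≤ (weights cs l).length := by
    have := h.path.top_sum; simp only [List.sum_cons] at this; rw [length_weights]; omega
  have htop := h.top_eq
  have hbot := h.bot_eq
  simp only [blockSums, List.cons.injEq] at htop hbot
  obtain ⟨h1, h2, h3⟩ := htop
  refine ⟨h.path.pure, ?_, ?_, ?_⟩
  · intro i hi
    refine h.label_lt i ?_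
    simp only [List.mem_append, List.mem_reverse] at hi
    rcases hi with hi | hi
    · exact List.mem_of_mem_drop (List.mem_of_mem_take hi)
    · exact hi
  · simp only [blockSums, weights_append, weights_reverse, weights_take, weights_drop]
    generalize weights cs l = W at *
    have hl : ((W.drop x).take y).reverse.length = y := by simp; omega
    congr 1
    · rw [List.take_append, hl, show x + 2 * y - y = x + y by omega, List.sum_append,
        List.take_of_length_le (by omega), List.sum_reverse, List.take_add, List.sum_append, h1, h2]
      ring
    · rw [List.drop_append, hl, show x + 2 * y - y = x + y by omega,
        List.drop_of_length_le (by omega), List.nil_append, ← List.drop_drop, h3]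
  · simp only [blockSums, weights_append, weights_reverse, weights_take, weights_drop]
    generalize weights cs l = W at *
    have hl : ((W.drop x).take y).reverse.length = y := by simp; omega
    congr 1
    · rw [List.take_left' hl, List.sum_reverse, h2]
    · rw [List.drop_left' hl, hbot]

theorem Expands.zero {as bs cs : List ℕ} {A B l : List ℕ}
    (h : Expands as bs cs ⟨A, B, l⟩) : Expands (0 :: as) bs cs ⟨0 :: A, B, l⟩ :=
  ⟨h.path.zero, h.label_lt, by simpa [blockSums] using h.top_eq, h.bot_eq⟩

theorem Expands.bl {β : ℕ} {as bs cs : List ℕ} {y : ℕ} {A B l : List ℕ}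
    (h : Expands (β :: as) bs cs ⟨y :: A, B, l⟩) :
    Expands ((2 * β) :: as) (β :: bs) cs
      ⟨(2 * y) :: A, y :: B, (l.take y).reverse ++ l⟩ := by
  simpa using h.zero.pure

theorem Expands.rot {α β : ℕ} {as bs cs : List ℕ} {x y : ℕ} {A B l : List ℕ}
    (h : Expands (α :: as) (β :: bs) cs ⟨x :: A, y :: B, l⟩) (hβ : β < α) :
    Expands ((2 * α - β) :: as) (α :: bs) cs
      ⟨(2 * x - y) :: A, x :: B, (l.take x).reverse ++ l.drop y⟩ := by
  have hlen : x ≤ (weights cs l).length := by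
    have := h.path.top_sum; simp only [List.sum_cons] at this; rw [length_weights]; omega
  have htop := h.top_eq
  have hbot := h.bot_eq
  simp only [blockSums, List.cons.injEq] at htop hbot
  obtain ⟨h1, h3⟩ := htop
  obtain ⟨h2, h4⟩ := hbot
  -- The first `y` vertices stand for fewer indices than the first `x`.
  have hyx : y ≤ x := by
    by_contra hxy
    rw [show y = x + (y - x) by omega, List.take_add, List.sum_append] at h2
    omega
  refine ⟨h.path.rot hyx, ?_, ?_, ?_⟩
  · intro i hi
    refine h.label_lt i ?_
    simp only [List.mem_append, List.mem_reverse] at hi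
    rcases hi with hi | hi
    · exact List.mem_of_mem_take hi
    · exact List.mem_of_mem_drop hi
  · simp only [blockSums, weights_append, weights_reverse, weights_take, weights_drop]
    generalize weights cs l = W at *
    have hl : (W.take x).reverse.length = x := by simp; omega
    congr 1
    · rw [List.take_append, hl, show 2 * x - y - x = x - y by omega, List.sum_append,
        List.take_of_length_le (by omega), List.sum_reverse, h1]
      have : (W.take x).sum = (W.take y).sum + ((W.drop y).take (x - y)).sum := by
        rw [← List.sum_append, ← List.take_add, Nat.add_sub_cancel' hyx]
      omega
    · rw [List.drop_append, hl, show 2 * x - y - x = x - y by omega,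
        List.drop_of_length_le (by omega), List.nil_append, List.drop_drop,
        Nat.add_sub_cancel' hyx, h3]
  · simp only [blockSums, weights_append, weights_reverse, weights_take, weights_drop]
    generalize weights cs l = W at *
    have hl : (W.take x).reverse.length = x := by simp; omega
    congr 1
    · rw [List.take_left' hl, List.sum_reverse, h1]
    · rw [List.drop_left' hl, h4]

/-- Replacing the vertices of the component meander by intervals of the sizes of the components
gives back the type of the seaweed. -/
theorem expands_signature (as bs : List ℕ) (ha : ∀ a ∈ as, 0 < a) (hb : ∀ b ∈ bs, 0 < b)
    (hab : as.sum = bs.sum) :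
    Expands as bs (deletions (signature as bs)) (windUp ((signature as bs).map Move.toUnit)) := by
  induction as, bs using signature.induct with
  | case1 a as b bs h =>
    have := ha a (by simp)
    have := hb b (by simp)
    omega
  | case2 as b bs h ih =>
    rw [signature, if_neg h, if_pos rfl]
    exact (ih (fun a h => ha a (by simp [h])) (fun a h => hb a (by simp [h]))
      (by simpa using hab)).comp _
  | case3 a as b bs h h1 h2 ih =>
    rw [signature, if_neg h, if_neg h1, if_pos h2]
    exact (ih hb ha hab.symm).flip
  | case4 as b bs h h1 h2 ih =>
    rw [signature, if_neg h, if_neg h1, if_neg h2, if_pos rfl]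
    have ih := ih (fun a h => by
        rcases List.mem_cons.1 h with rfl | h
        · exact hb _ (by simp)
        · exact ha a (by simp [h]))
      (fun a h => hb a (by simp [h])) (by simp only [List.sum_cons] at hab ⊢; omega)
    simp only [List.map_cons, Move.toUnit, windUp, deletions]
    generalize windUp ((signature (b :: as) bs).map Move.toUnit) = M at ih ⊢
    obtain ⟨_ | ⟨y, A⟩, B, l⟩ := M
    · exact absurd ih.top_eq (by simp [blockSums])
    · exact ih.bl
  | case5 a as b bs h h1 h2 h3 h4 ih =>
    rw [signature, if_neg h, if_neg h1, if_neg h2, if_neg h3, if_pos h4]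
    have ih := ih (fun a h => by
        rcases List.mem_cons.1 h with rfl | h
        · exact hb _ (by simp)
        · exact ha a (by simp [h]))
      (fun a h => by
        rcases List.mem_cons.1 h with rfl | h
        · omega
        · exact hb a (by simp [h])) (by simp only [List.sum_cons] at hab ⊢; omega)
    simp only [List.map_cons, Move.toUnit, windUp, deletions]
    generalize windUp ((signature (b :: as) ((2 * b - a) :: bs)).map Move.toUnit) = M at ih ⊢
    obtain ⟨_ | ⟨x, A⟩, _ | ⟨y, B⟩, l⟩ := M
    · exact absurd ih.top_eq (by simp [blockSums])
    · exact absurd ih.top_eq (by simp [blockSums])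
    · exact absurd ih.bot_eq (by simp [blockSums])
    · have := ih.rot (by omega)
      rwa [show 2 * b - (2 * b - a) = a by omega] at this
  | case6 a as b bs h h1 h2 h3 h4 ih =>
    rw [signature, if_neg h, if_neg h1, if_neg h2, if_neg h3, if_neg h4]
    have ih := ih (fun a h => by
        rcases List.mem_cons.1 h with rfl | h
        · omega
        rcases List.mem_cons.1 h with rfl | h
        · exact hb _ (by simp)
        · exact ha a (by simp [h]))
      (fun a h => hb a (by simp [h])) (by simp only [List.sum_cons] at hab ⊢; omega)
    simp only [List.map_cons, Move.toUnit, windUp, deletions]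
    generalize windUp ((signature ((a - 2 * b) :: b :: as) bs).map Move.toUnit) = M at ih ⊢
    obtain ⟨_ | ⟨x, _ | ⟨y, A⟩⟩, B, l⟩ := M
    · exact absurd ih.top_eq (by simp [blockSums])
    · exact absurd ih.top_eq (by simp [blockSums])
    · have := ih.pure
      rwa [show a - 2 * b + 2 * b = a by omega] at this
  | case7 as bs h =>
    have hnil : as = [] ∧ bs = [] := by
      rcases as with _ | ⟨a, as⟩ <;> rcases bs with _ | ⟨b, bs⟩
      · simp
      · have := hb b (by simp)
        simp only [List.sum_nil, List.sum_cons] at hab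
        omega
      · have := ha a (by simp)
        simp only [List.sum_nil, List.sum_cons] at hab
        omega
      · exact (h _ _ _ _ rfl rfl).elim
    obtain ⟨rfl, rfl⟩ := hnil
    simpa [signature, deletions, windUp] using Expands.nil

/-! ### Seaweeds as spaces of matrices with prescribed support -/

theorem mem_coordSpan {n : ℕ} {p : ℕ → Prop} {v : Fin n → ℂ} :
    v ∈ coordSpan n p ↔ ∀ k : Fin n, ¬ p k → v k = 0 := by
  constructor
  · intro h k hk
    induction h using Submodule.span_induction with
    | mem x hx =>
      obtain ⟨j, hj, rfl⟩ := hx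
      exact Pi.single_eq_of_ne (by rintro rfl; exact hk hj) _
    | zero => rfl
    | add x y _ _ hx hy => simp [hx, hy]
    | smul r x _ hx => simp [hx]
  · intro h
    rw [pi_eq_sum_univ' v]
    refine Submodule.sum_mem _ fun k _ => ?_
    by_cases hk : p k
    · refine Submodule.smul_mem _ _ (Submodule.subset_span ⟨k, hk, ?_⟩)
      funext j
      simp [Pi.single_apply, eq_comm]
    · simp [h k hk]

/-- A matrix preserves a coordinate subspace if and only if the entries leading out of it vanish. -/
theorem mulVec_mem_coordSpan {n : ℕ} {p : ℕ → Prop} {X : Matrix (Fin n) (Fin n) ℂ} :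
    (∀ v ∈ coordSpan n p, X.mulVec v ∈ coordSpan n p) ↔
      ∀ i j : Fin n, ¬ p i → p j → X i j = 0 := by
  simp only [mem_coordSpan]
  constructor
  · intro h i j hi hj
    have := h (Pi.single j 1) (fun k hk => Pi.single_eq_of_ne (by rintro rfl; exact hk hj) _) i hi
    simpa using this
  · intro h v hv i hi
    change ∑ j, X i j * v j = 0
    refine Finset.sum_eq_zero fun j _ => ?_
    by_cases hj : p j
    · rw [h i j hi hj, zero_mul]
    · rw [hv j hj, mul_zero]

theorem sameBlock_iff {l : List ℕ} {u v : ℕ} (hu : u < l.sum) (hv : v < l.sum) :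
    SameBlock l u v ↔ ∀ i ≤ l.length, (u < (l.take i).sum ↔ v < (l.take i).sum) := by
  induction l generalizing u v with
  | nil => simp at hu
  | cons a l ih =>
    simp only [List.sum_cons] at hu hv
    simp only [SameBlock]
    constructor
    · rintro (⟨h1, h2⟩ | ⟨h1, h2, h3⟩) (_ | i) hi
      · simp
      · simp only [List.take_succ_cons, List.sum_cons]
        omega
      · simp
      · have := (ih (by omega) (by omega)).1 h3 i (by simpa using hi)
        simp only [List.take_succ_cons, List.sum_cons]
        omega
    · intro h
      have h1 := h 1 (by simp)
      simp only [List.take_succ_cons, List.take_zero, List.sum_cons, List.sum_nil] at h1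
      by_cases hua : u < a
      · left; omega
      · right
        refine ⟨by omega, by omega, (ih (by omega) (by omega)).2 fun i hi => ?_⟩
        have := h (i + 1) (by simpa using hi)
        simp only [List.take_succ_cons, List.sum_cons] at this
        omega

/-- The seaweed consists of the matrices supported on `Supp`. An entry in row `p` and column `q < p`
is obstructed by a space `V_i` that separates `q` from `p`, so it is free if `p` and `q` share a top
block; above the diagonal the same holds for the `W_j` and the bottom blocks. -/
theorem mem_seaweed {n : ℕ} {a b : Composition n} {X : Matrix (Fin n) (Fin n) ℂ} :
    X ∈ seaweed a b ↔ ∀ p q : Fin n, ¬ Supp a.blocks b.blocks p q → X p q = 0 := by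
  have h0 : X ∈ seaweed a b ↔
      (∀ i ≤ a.length, ∀ p q : Fin n, ¬ (p : ℕ) < a.sizeUpTo i → (q : ℕ) < a.sizeUpTo i →
        X p q = 0) ∧
      (∀ j ≤ b.length, ∀ p q : Fin n, ¬ b.sizeUpTo j ≤ (p : ℕ) → b.sizeUpTo j ≤ (q : ℕ) →
        X p q = 0) := by
    change ((∀ i ≤ a.length, ∀ v ∈ flagV a i, X.mulVec v ∈ flagV a i) ∧
      (∀ j ≤ b.length, ∀ v ∈ flagW b j, X.mulVec v ∈ flagW b j)) ↔ _
    simp only [flagV, flagW, mulVec_mem_coordSpan]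
  have hlt : ∀ (c : Composition n) (p : Fin n), (p : ℕ) < c.blocks.sum := fun c p => by
    rw [c.blocks_sum]; exact p.2
  rw [h0]
  simp only [Supp, sameBlock_iff (hlt _ _) (hlt _ _)]
  constructor
  · rintro ⟨h1, h2⟩ p q hpq
    push Not at hpq
    rcases le_total (q : ℕ) p with h | h
    · obtain ⟨i, hi, hne⟩ := hpq.1 h
      rcases hne with hne | hne
      · omega
      · exact h1 i hi p q (Nat.not_lt.2 hne.1) hne.2
    · obtain ⟨i, hi, hne⟩ := hpq.2 h
      rcases hne with hne | hne
      · exact h2 i hi p q (Nat.not_le.2 hne.1) hne.2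
      · omega
  · intro h
    refine ⟨fun i hi p q hp hq => h p q ?_, fun i hi p q hp hq => h p q ?_⟩
    · rintro (⟨h1, h2⟩ | ⟨h1, h2⟩)
      · exact hp ((h2 i hi).2 hq)
      · exact hp (lt_of_le_of_lt h1 hq)
    · rintro (⟨h1, h2⟩ | ⟨h1, h2⟩)
      · exact hp (le_trans hq h1)
      · exact absurd ((h2 i hi).1 (Nat.not_le.1 hp)) (Nat.not_lt.2 hq)

/-- An index in the interval of `v` comes before the interval of `w`, if `v < w`. -/
theorem sum_take_add_lt {W : List ℕ} {v w s : ℕ} (hvw : v < w) (hs : s < W.getD v 0) :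
    (W.take v).sum + s < (W.take w).sum := by
  have hv : v < W.length := by
    by_contra h
    rw [List.getD_eq_default _ _ (by omega)] at hs
    omega
  have h1 : (W.take (v + 1)).sum = (W.take v).sum + W.getD v 0 := by
    rw [List.sum_take_succ _ _ hv, List.getD_eq_getElem _ _ hv]
  have h2 : (W.take w).sum = (W.take (v + 1)).sum + ((W.drop (v + 1)).take (w - (v + 1))).sum := by
    rw [← List.sum_append, ← List.take_add, Nat.add_sub_cancel' hvw]
  omega

theorem sum_take_le {W : List ℕ} {v w : ℕ} (hvw : v ≤ w) : (W.take v).sum ≤ (W.take w).sum := by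
  have h2 : (W.take w).sum = (W.take v).sum + ((W.drop v).take (w - v)).sum := by
    rw [← List.sum_append, ← List.take_add, Nat.add_sub_cancel' hvw]
  omega

theorem sameBlock_blockSums {l W : List ℕ} {v w s t : ℕ}
    (hs : s < W.getD v 0) (ht : t < W.getD w 0) :
    SameBlock (blockSums l W) ((W.take v).sum + s) ((W.take w).sum + t) ↔ SameBlock l v w := by
  induction l generalizing W v w with
  | nil => rfl
  | cons k l ih =>
    simp only [blockSums, SameBlock]
    have hlt : ∀ {v s : ℕ}, s < W.getD v 0 → ((W.take v).sum + s < (W.take k).sum ↔ v < k) := by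
      intro v s hs
      refine ⟨fun h => ?_, fun h => sum_take_add_lt h hs⟩
      by_contra hk
      have := sum_take_le (W := W) (Nat.not_lt.1 hk)
      omega
    have hge : ∀ {v s : ℕ}, k ≤ v →
        (W.take v).sum + s - (W.take k).sum = ((W.drop k).take (v - k)).sum + s := by
      intro v s hk
      have : (W.take v).sum = (W.take k).sum + ((W.drop k).take (v - k)).sum := by
        rw [← List.sum_append, ← List.take_add, Nat.add_sub_cancel' hk]
      omega
    have hd : ∀ {v : ℕ}, k ≤ v → (W.drop k).getD (v - k) 0 = W.getD v 0 := by
      intro v hk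
      rw [List.getD_eq_getElem?_getD, List.getElem?_drop, Nat.add_sub_cancel' hk,
        List.getD_eq_getElem?_getD]
    rw [hlt hs, hlt ht, ← Nat.not_lt, ← Nat.not_lt, hlt hs, hlt ht]
    refine or_congr Iff.rfl ?_
    rw [Nat.not_lt, Nat.not_lt]
    refine and_congr_right fun hv => and_congr_right fun hw => ?_
    rw [hge hv, hge hw]
    exact ih (by rwa [hd hv]) (by rwa [hd hw])

/-- Replacing vertices by intervals does not change the support, in terms of vertices. Inside the
interval of a vertex all entries are allowed. -/
theorem supp_blockSums {top bot W : List ℕ} {v w s t : ℕ} (htop : top.sum = W.length)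
    (hbot : bot.sum = W.length)
    (hs : s < W.getD v 0) (ht : t < W.getD w 0) :
    Supp (blockSums top W) (blockSums bot W) ((W.take v).sum + s) ((W.take w).sum + t) ↔
      Supp top bot v w := by
  simp only [Supp, sameBlock_blockSums hs ht]
  rcases lt_trichotomy v w with h | rfl | h
  · have := sum_take_add_lt h hs
    refine or_congr (and_congr_left' ?_) (and_congr_left' ?_) <;> omega
  · have hv : v < W.length := by
      by_contra h
      rw [List.getD_eq_default _ _ (by omega)] at hs
      omega
    have h1 : SameBlock top v v := sameBlock_refl (by omega)
    have h2 : SameBlock bot v v := sameBlock_refl (by omega)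
    simp only [h1, h2, and_true, le_refl, or_true, iff_true]
    exact le_total _ _
  · have := sum_take_add_lt h ht
    refine or_congr (and_congr_left' ?_) (and_congr_left' ?_) <;> omega

theorem sum_blockSums {l W : List ℕ} (h : l.sum = W.length) : (blockSums l W).sum = W.sum := by
  induction l generalizing W with
  | nil =>
    have : W = [] := List.length_eq_zero_iff.1 (by simpa using h.symm)
    simp [blockSums, this]
  | cons k l ih =>
    simp only [List.sum_cons] at h
    rw [blockSums, List.sum_cons, ih (by rw [List.length_drop]; omega), ← List.sum_append,
      List.take_append_drop]

/-- The edges of a meander join the positions to their mirror images. -/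
theorem isArc_iff {l : List ℕ} {u v : ℕ} :
    IsArc l u v ↔ u < v ∧ u < l.sum ∧ mirror l u = v := by
  have key : ∀ (l : List ℕ) (u v : ℕ), u < v → ((∃ k < l.length,
      (l.take k).sum ≤ u ∧ u + v + 1 = 2 * (l.take k).sum + l.getD k 0) ↔
      u < l.sum ∧ mirror l u = v) := by
    intro l
    induction l with
    | nil => simp
    | cons a l ih =>
      intro u v huv
      rw [List.sum_cons, mirror]
      constructor
      · rintro ⟨_ | k, hk, h1, h2⟩
        · simp only [List.take_zero, List.sum_nil, List.getD_cons_zero] at h1 h2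
          rw [if_pos (by omega)]
          omega
        · simp only [List.take_succ_cons, List.sum_cons, List.getD_cons_succ] at h1 h2
          have := (ih (u - a) (v - a) (by omega)).1
            ⟨k, by simpa using hk, by omega, by omega⟩
          rw [if_neg (by omega)]
          omega
      · rintro ⟨h1, h2⟩
        split_ifs at h2 with hua
        · exact ⟨0, by simp, by simp, by simp; omega⟩
        · obtain ⟨k, hk, h3, h4⟩ := (ih (u - a) (v - a) (by omega)).2 (by omega)
          refine ⟨k + 1, by simpa using hk, ?_, ?_⟩
          · simp only [List.take_succ_cons, List.sum_cons]
            omega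
          · simp only [List.take_succ_cons, List.sum_cons, List.getD_cons_succ]
            omega
  unfold IsArc
  exact and_congr_right fun huv => key l u v huv

/-! ### From labelled paths to finite systems of paths -/

section

variable {top bot label : List ℕ} {E : Fin label.length → Fin label.length → Prop}

/-- An oriented edge in terms of its starting point. -/
theorem edge_iff (h : PathMeander top bot label)
    (hE : ∀ u v, E u v ↔ IsArc top v u ∨ IsArc bot u v) (u v : Fin label.length) :
    E u v ↔ ((v : ℕ) < u ∧ (v : ℕ) = mirror top u) ∨ ((u : ℕ) < v ∧ (v : ℕ) = mirror bot u) := by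
  rw [hE, isArc_iff, isArc_iff, h.top_sum, h.bot_sum]
  have e1 : mirror top v = (u : ℕ) ↔ (v : ℕ) = mirror top u := by
    constructor <;> intro h
    · rw [← h, mirror_mirror]
    · rw [h, mirror_mirror]
  rw [e1]
  have := u.2
  have := v.2
  constructor
  · rintro (⟨h1, _, h2⟩ | ⟨h1, _, h2⟩)
    · exact Or.inl ⟨h1, h2⟩
    · exact Or.inr ⟨h1, h2.symm⟩
  · rintro (⟨h1, h2⟩ | ⟨h1, h2⟩)
    · exact Or.inl ⟨h1, v.2, h2⟩
    · exact Or.inr ⟨h1, u.2, h2.symm⟩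

/-- An oriented edge in terms of its end point. -/
theorem edge_iff' (h : PathMeander top bot label)
    (hE : ∀ u v, E u v ↔ IsArc top v u ∨ IsArc bot u v) (u v : Fin label.length) :
    E u v ↔ ((v : ℕ) < u ∧ (u : ℕ) = mirror top v) ∨ ((u : ℕ) < v ∧ (u : ℕ) = mirror bot v) := by
  rw [edge_iff h hE]
  have : ∀ l, ((v : ℕ) = mirror l u ↔ (u : ℕ) = mirror l v) := by
    intro l
    constructor <;> intro h
    · rw [h, mirror_mirror]
    · rw [h, mirror_mirror]
  rw [this, this]

/-- A sum over at most two vertices, given by their positions. -/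
theorem sum_two_terms {N : ℕ} {P Q : Prop} [Decidable P] [Decidable Q] {i j : ℕ}
    {R : Fin N → Prop} [DecidablePred R] (hi : i < N) (hj : j < N)
    (hR : ∀ w, R w ↔ (P ∧ (w : ℕ) = i) ∨ (Q ∧ (w : ℕ) = j)) (hPQ : P → Q → i ≠ j)
    (f : Fin N → ℂ) (g : ℕ → ℂ) (hg : ∀ w, f w = g w) :
    (∑ w, if R w then f w else 0) = (if P then g i else 0) + if Q then g j else 0 := by
  have : ∀ w : Fin N, (if R w then f w else 0) =
      (if P ∧ w = ⟨i, hi⟩ then g i else 0) + if Q ∧ w = ⟨j, hj⟩ then g j else 0 := by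
    intro w
    simp only [Fin.ext_iff]
    have := hR w
    by_cases h1 : P ∧ (w : ℕ) = i <;> by_cases h2 : Q ∧ (w : ℕ) = j
    · exact absurd (h1.2.symm.trans h2.2) (hPQ h1.1 h2.1)
    · rw [if_pos (this.2 (Or.inl h1)), if_pos h1, if_neg h2, hg, h1.2, add_zero]
    · rw [if_pos (this.2 (Or.inr h2)), if_neg h1, if_pos h2, hg, h2.2, zero_add]
    · rw [if_neg (fun h => (this.1 h).elim h1 h2), if_neg h1, if_neg h2, add_zero]
  simp only [this, Finset.sum_add_distrib, ite_and]
  congr 1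
  · split_ifs <;> simp
  · split_ifs <;> simp

/-- The passage from positions in `ℕ` and mirror involutions to the finite graph of oriented
edges. -/
theorem PathMeander.pathSystem (h : PathMeander top bot label) {k : ℕ}
    (lab : Fin label.length → Fin k) (hlab : ∀ v, label.get v = lab v)
    (hsurj : Function.Surjective lab) [DecidableRel E]
    (hE : ∀ u v, E u v ↔ IsArc top v u ∨ IsArc bot u v) :
    PathSystem (fun u v : Fin label.length => Supp top bot u v) E lab := by
  have htop : ∀ v : ℕ, v < label.length → mirror top v < label.length := fun v hv => by
    rw [← h.top_sum] at *; exact mirror_lt_sum hv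
  have hbot : ∀ v : ℕ, v < label.length → mirror bot v < label.length := fun v hv => by
    rw [← h.bot_sum] at *; exact mirror_lt_sum hv
  have hlab' : ∀ u v : Fin label.length, lab u = lab v ↔ label[(u : ℕ)]? = label[(v : ℕ)]? := by
    intro u v
    rw [List.getElem?_eq_getElem u.2, List.getElem?_eq_getElem v.2, Fin.ext_iff, ← hlab, ← hlab]
    simp
  refine ⟨fun v => Or.inl ⟨le_rfl, sameBlock_refl (by rw [h.top_sum]; exact v.2)⟩, ?_, ?_, hsurj,
    ?_, ?_, ?_⟩
  · intro u v huv
    rw [edge_iff h hE] at huv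
    rcases huv with ⟨h1, h2⟩ | ⟨h1, h2⟩
    · refine Or.inl ⟨h1.le, ?_⟩
      rw [h2]
      exact sameBlock_mirror (by rw [h.top_sum]; exact u.2)
    · refine Or.inr ⟨h1.le, ?_⟩
      rw [h2]
      exact sameBlock_mirror (by rw [h.bot_sum]; exact u.2)
  · intro u v huv
    rw [edge_iff h hE] at huv
    rw [hlab']
    rcases huv with ⟨h1, h2⟩ | ⟨h1, h2⟩
    · rw [h2, h.label_top]
    · rw [h2, h.label_bot]
  · obtain ⟨d, d1, d2⟩ := h.graded
    refine ⟨fun v => d v, fun u v huv => ?_⟩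
    rw [edge_iff' h hE] at huv
    beta_reduce
    rcases huv with ⟨h1, h2⟩ | ⟨h1, h2⟩
    · rw [h2]
      exact d1 _ (h2 ▸ h1)
    · rw [h2]
      exact d2 _ (h2 ▸ h1)
  · intro g hg u v huv
    set g' : ℕ → Prop := fun w => ∀ hw : w < label.length, g ⟨w, hw⟩ = g u with hg'
    have hinv : ∀ (w w' : ℕ) (hw : w < label.length) (hw' : w' < label.length),
        (w = w' ∨ E ⟨w, hw⟩ ⟨w', hw'⟩ ∨ E ⟨w', hw'⟩ ⟨w, hw⟩) → (g' w ↔ g' w') := by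
      intro w w' hw hw' hc
      have : g ⟨w, hw⟩ = g ⟨w', hw'⟩ := by
        rcases hc with rfl | hc | hc
        · rfl
        · exact hg _ _ hc
        · exact (hg _ _ hc).symm
      simp only [hg', hw, hw', forall_true_left, this]
    have key := h.connected g' (fun w => ?_) (fun w => ?_) u v u.2 ((hlab' u v).1 huv)
    · exact ((key.1 fun _ => rfl) v.2).symm
    · by_cases hw : w < label.length
      · refine hinv _ _ (htop w hw) hw ?_
        rcases lt_trichotomy (mirror top w) w with hlt | heq | hlt
        · exact Or.inr (Or.inr ((edge_iff h hE _ _).2 (Or.inl ⟨hlt, rfl⟩)))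
        · exact Or.inl heq
        · exact Or.inr (Or.inl ((edge_iff' h hE _ _).2 (Or.inl ⟨hlt, rfl⟩)))
      · rw [mirror_of_sum_le (by rw [h.top_sum]; omega)]
    · by_cases hw : w < label.length
      · refine hinv _ _ (hbot w hw) hw ?_
        rcases lt_trichotomy (mirror bot w) w with hlt | heq | hlt
        · exact Or.inr (Or.inl ((edge_iff' h hE _ _).2 (Or.inr ⟨hlt, rfl⟩)))
        · exact Or.inl heq
        · exact Or.inr (Or.inr ((edge_iff h hE _ _).2 (Or.inr ⟨hlt, rfl⟩)))
      · rw [mirror_of_sum_le (by rw [h.bot_sum]; omega)]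
  · intro x hx he u v huv
    set y : ℕ → ℕ → ℂ := fun p q =>
      if hpq : p < label.length ∧ q < label.length then x ⟨p, hpq.1⟩ ⟨q, hpq.2⟩ else 0 with hy
    have hyx : ∀ u v : Fin label.length, x u v = y u v := by
      intro u v; simp [hy]
    have key := h.rigid y ?_ ?_ u v (fun h => huv (Fin.ext h))
    · rw [hyx]; exact key
    · intro p q hpq
      simp only [hy]
      split_ifs with hr
      · exact hx _ _ hpq
      · rfl
    · intro p q hpq
      have hp : p < label.length := by
        rcases hpq with ⟨_, h'⟩ | ⟨_, h'⟩
        · rw [← h.top_sum]; exact h'.lt_sum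
        · rw [← h.bot_sum]; exact h'.lt_sum
      have hq : q < label.length := by
        rcases hpq with ⟨_, h'⟩ | ⟨_, h'⟩
        · rw [← h.top_sum]; exact h'.symm.lt_sum
        · rw [← h.bot_sum]; exact h'.symm.lt_sum
      have E1 := he ⟨p, hp⟩ ⟨q, hq⟩ hpq
      rw [sum_two_terms (P := q < mirror top q) (Q := mirror bot q < q) (htop q hq) (hbot q hq)
          (fun w => by rw [edge_iff' h hE]; simp only; omega) (by omega) _ (fun w => y w p)
          (fun w => hyx w ⟨p, hp⟩),
        sum_two_terms (P := mirror top p < p) (Q := p < mirror bot p) (htop p hp) (hbot p hp)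
          (fun w => by rw [edge_iff h hE]; simp only; omega) (by omega) _ (fun w => y q w)
          (fun w => hyx ⟨q, hq⟩ w)] at E1
      simp only [defect]
      linear_combination E1

end

/-! ### The component meander and the coefficients of the functionals -/

theorem expands_compMeander {n : ℕ} (a b : Composition n) :
    Expands a.blocks b.blocks (homotopyType a b) (compMeander a b) :=
  expands_signature _ _ (fun _ h => a.blocks_pos h) (fun _ h => b.blocks_pos h)
    (by rw [a.blocks_sum, b.blocks_sum])

/-- The component of the homotopy type to which a vertex of the component meander belongs. -/
def vertexComp {n : ℕ} (a b : Composition n) (v : CMVertex a b) : Fin (numComp a b) :=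
  ⟨(compMeander a b).label.get v, (expands_compMeander a b).label_lt _ (List.get_mem _ _)⟩

section

variable {n : ℕ} {a b : Composition n}

theorem onPath_iff {i : Fin (numComp a b)} {v : CMVertex a b} :
    OnPath a b i v ↔ vertexComp a b v = i := by
  rw [OnPath, Fin.ext_iff]; rfl

/-- The lengths of the intervals for which the vertices of the component meander stand. -/
abbrev vertexWeights {n : ℕ} (a b : Composition n) : List ℕ :=
  weights (homotopyType a b) (compMeander a b).label

theorem minIdx_eq (v : CMVertex a b) : minIdx a b v = ((vertexWeights a b).take v).sum := by
  rw [minIdx, vertexWeights, ← weights_take]; rfl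

theorem compSize_vertexComp (v : CMVertex a b) :
    compSize a b (vertexComp a b v) = (vertexWeights a b).getD v 0 := by
  have hv : (v : ℕ) < (vertexWeights a b).length := by rw [length_weights]; exact v.2
  rw [List.getD_eq_getElem _ _ hv]
  simp only [vertexWeights, weights, List.getElem_map]
  have := (vertexComp a b v).2
  exact (List.getD_eq_getElem _ _ this).symm

theorem sum_vertexWeights : (vertexWeights a b).sum = n := by
  have h := expands_compMeander a b
  rw [← sum_blockSums (l := (compMeander a b).top) (by rw [length_weights, h.path.top_sum]),
    h.top_eq, a.blocks_sum]

theorem exists_sum_take_add_eq (W : List ℕ) (p : ℕ) (hp : p < W.sum) :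
    ∃ v < W.length, ∃ s < W.getD v 0, (W.take v).sum + s = p := by
  induction W generalizing p with
  | nil => simp at hp
  | cons w W ih =>
    by_cases h : p < w
    · exact ⟨0, by simp, p, by simpa using h, by simp⟩
    · rw [List.sum_cons] at hp
      obtain ⟨v, hv, s, hs, hvs⟩ := ih (p - w) (by omega)
      refine ⟨v + 1, by simpa using hv, s, by simpa using hs, ?_⟩
      rw [List.take_succ_cons, List.sum_cons]
      omega

theorem minIdx_add_lt (v : CMVertex a b) {s : ℕ} (hs : s < compSize a b (vertexComp a b v)) :
    minIdx a b v + s < n := by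
  rw [compSize_vertexComp] at hs
  have h := sum_take_add_lt (w := (vertexWeights a b).length)
    (by rw [length_weights]; exact v.2) hs
  rwa [List.take_length, sum_vertexWeights, ← minIdx_eq] at h

theorem minIdx_add_inj {u v : CMVertex a b} {s t : ℕ} (hs : s < compSize a b (vertexComp a b u))
    (ht : t < compSize a b (vertexComp a b v)) (h : minIdx a b u + s = minIdx a b v + t) :
    u = v ∧ s = t := by
  rw [compSize_vertexComp] at hs ht
  rw [minIdx_eq, minIdx_eq] at h
  rcases lt_trichotomy (u : ℕ) v with huv | huv | huv
  · have := sum_take_add_lt huv hs; omega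
  · obtain rfl := Fin.ext huv
    exact ⟨rfl, by omega⟩
  · have := sum_take_add_lt huv ht; omega

/-- The intervals for which the vertices stand partition the indices: an index is given by a vertex
and an offset in its interval. -/
noncomputable def blockEquiv {n : ℕ} (a b : Composition n) :
    (Σ v : CMVertex a b, Fin (compSize a b (vertexComp a b v))) ≃ Fin n :=
  Equiv.ofBijective (fun x => ⟨minIdx a b x.1 + x.2, minIdx_add_lt x.1 x.2.2⟩) (by
    constructor
    · rintro ⟨u, s⟩ ⟨v, t⟩ h
      obtain ⟨rfl, hst⟩ := minIdx_add_inj s.2 t.2 (Fin.ext_iff.1 h)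
      obtain rfl := Fin.ext hst
      rfl
    · intro p
      obtain ⟨v, hv, s, hs, hvs⟩ := exists_sum_take_add_eq (vertexWeights a b) p
        (by rw [sum_vertexWeights]; exact p.2)
      rw [length_weights] at hv
      refine ⟨⟨⟨v, hv⟩, s, ?_⟩, Fin.ext ?_⟩
      · rw [compSize_vertexComp]; exact hs
      · simp only [minIdx_eq]; exact hvs)

theorem minIdx_add_eq_iff {v : CMVertex a b} {s : ℕ} (hs : s < compSize a b (vertexComp a b v))
    (p : Fin n) : minIdx a b v + s = p ↔
      v = ((blockEquiv a b).symm p).1 ∧ s = ((blockEquiv a b).symm p).2 := by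
  have hp : (p : ℕ) = minIdx a b ((blockEquiv a b).symm p).1 + ((blockEquiv a b).symm p).2 := by
    conv_lhs => rw [← (blockEquiv a b).apply_symm_apply p]
    rfl
  constructor
  · intro h
    exact minIdx_add_inj hs ((blockEquiv a b).symm p).2.2 (h.trans hp)
  · rintro ⟨h1, h2⟩
    rw [hp, h1, h2]

theorem supp_blockEquiv_symm (p q : Fin n) : Supp a.blocks b.blocks p q ↔
    Supp (compMeander a b).top (compMeander a b).bot ((blockEquiv a b).symm p).1
      ((blockEquiv a b).symm q).1 := by
  have h := expands_compMeander a b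
  have hp := (minIdx_add_eq_iff ((blockEquiv a b).symm p).2.2 p).2 ⟨rfl, rfl⟩
  have hq := (minIdx_add_eq_iff ((blockEquiv a b).symm q).2.2 q).2 ⟨rfl, rfl⟩
  rw [minIdx_eq] at hp hq
  rw [← hp, ← hq]
  have e1 : a.blocks = blockSums (compMeander a b).top (vertexWeights a b) := h.top_eq.symm
  have e2 : b.blocks = blockSums (compMeander a b).bot (vertexWeights a b) := h.bot_eq.symm
  rw [e1, e2]
  refine supp_blockSums ?_ ?_ ?_ ?_
  · rw [h.path.top_sum, length_weights]
  · rw [h.path.bot_sum, length_weights]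
  · rw [← compSize_vertexComp]; exact ((blockEquiv a b).symm p).2.2
  · rw [← compSize_vertexComp]; exact ((blockEquiv a b).symm q).2.2

theorem entry_single (i j : ℕ) (p q : Fin n) :
    entry n i j (Matrix.single p q 1) = if i = p ∧ j = q then 1 else 0 := by
  unfold entry
  split_ifs with h1 h2 h2
  · obtain ⟨rfl, rfl⟩ := h2
    simp
  · rw [Matrix.entryLinearMap_apply, Matrix.single_apply, if_neg]
    rintro ⟨rfl, rfl⟩
    exact h2 ⟨rfl, rfl⟩
  · exact absurd ⟨h2.1 ▸ p.2, h2.2 ▸ q.2⟩ h1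
  · rfl

/-- The coefficients of a copy of `F` in the core block of `v`. -/
theorem shift_single {i : Fin (numComp a b)}
    (F : Module.Dual ℂ (Matrix (Fin (compSize a b i)) (Fin (compSize a b i)) ℂ))
    {v : CMVertex a b} (hv : vertexComp a b v = i) (p q : Fin n) :
    shift n F (minIdx a b v) (Matrix.single p q 1) =
      if v = ((blockEquiv a b).symm p).1 ∧ v = ((blockEquiv a b).symm q).1 then
        coeff F ((blockEquiv a b).symm p).2 ((blockEquiv a b).symm q).2 else 0 := by
  subst hv
  have hs : ∀ s t : Fin (compSize a b (vertexComp a b v)),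
      (F (Matrix.single s t 1) • entry n (s + minIdx a b v) (t + minIdx a b v))
        (Matrix.single p q 1) =
      if (v = ((blockEquiv a b).symm p).1 ∧ (s : ℕ) = ((blockEquiv a b).symm p).2) ∧
        (v = ((blockEquiv a b).symm q).1 ∧ (t : ℕ) = ((blockEquiv a b).symm q).2) then
        F (Matrix.single s t 1) else 0 := by
    intro s t
    rw [LinearMap.smul_apply, entry_single, add_comm (s : ℕ), add_comm (t : ℕ)]
    simp only [minIdx_add_eq_iff s.2, minIdx_add_eq_iff t.2, smul_eq_mul, mul_ite, mul_one,
      mul_zero]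
  simp only [shift, LinearMap.sum_apply, hs]
  by_cases h : v = ((blockEquiv a b).symm p).1 ∧ v = ((blockEquiv a b).symm q).1
  · obtain ⟨h1, h2⟩ := h
    have l1 : (((blockEquiv a b).symm p).2 : ℕ) < compSize a b (vertexComp a b v) :=
      lt_of_lt_of_eq ((blockEquiv a b).symm p).2.2 (by rw [← h1])
    have l2 : (((blockEquiv a b).symm q).2 : ℕ) < compSize a b (vertexComp a b v) :=
      lt_of_lt_of_eq ((blockEquiv a b).symm q).2.2 (by rw [← h2])
    rw [Finset.sum_eq_single ⟨_, l1⟩, Finset.sum_eq_single ⟨_, l2⟩, if_pos ⟨⟨h1, rfl⟩, h2, rfl⟩,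
      if_pos ⟨h1, h2⟩, coeff, dif_pos ⟨l1, l2⟩]
    · intro t _ ht
      exact if_neg fun h => ht (Fin.ext h.2.2)
    · simp
    · intro s _ hs
      exact Finset.sum_eq_zero fun t _ => if_neg fun h => hs (Fin.ext h.1.2)
    · simp
  · rw [if_neg h]
    exact Finset.sum_eq_zero fun s _ => Finset.sum_eq_zero fun t _ =>
      if_neg fun h' => h ⟨h'.1.1, h'.2.1⟩

/-- The coefficients of a sum of functionals `H i v` in all the core blocks. -/
theorem sum_shift_single
    (H : ∀ i, CMVertex a b → Module.Dual ℂ (Matrix (Fin (compSize a b i)) (Fin (compSize a b i)) ℂ))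
    (p q : Fin n) :
    ∑ i, ∑ v ∈ pathVertices a b i, shift n (H i v) (minIdx a b v) (Matrix.single p q 1) =
      if ((blockEquiv a b).symm p).1 = ((blockEquiv a b).symm q).1 then
        coeff (H (vertexComp a b ((blockEquiv a b).symm p).1) ((blockEquiv a b).symm p).1)
          ((blockEquiv a b).symm p).2 ((blockEquiv a b).symm q).2 else 0 := by
  have h1 : ∀ i, ∀ v ∈ pathVertices a b i, vertexComp a b v = i := by
    intro i v hv
    simpa [pathVertices, onPath_iff] using hv
  rw [Finset.sum_congr rfl fun i _ => Finset.sum_congr rfl fun v hv =>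
    shift_single (H i v) (h1 i v hv) p q,
    Finset.sum_eq_single (vertexComp a b ((blockEquiv a b).symm p).1),
    Finset.sum_eq_single ((blockEquiv a b).symm p).1]
  · exact if_congr (by simp) rfl rfl
  · intro v _ hv
    exact if_neg fun h => hv h.1
  · intro h
    exact absurd (by simp [pathVertices, onPath_iff]) h
  · intro i _ hi
    refine Finset.sum_eq_zero fun v hv => if_neg fun h => hi ?_
    rw [← h.1, h1 i v hv]
  · simp

/-- The coefficients of a transversal in the block of the vertices `u` and `v`: the map `r` is the
identity for the main diagonal, and the reversal for the antidiagonal. -/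
theorem sum_entry_single {i : Fin (numComp a b)} {u v : CMVertex a b}
    (hu : vertexComp a b u = i) (hv : vertexComp a b v = i) (r : ℕ → ℕ)
    (hr : ∀ s < compSize a b i, r s < compSize a b i) (p q : Fin n) :
    ∑ s ∈ Finset.range (compSize a b i),
      entry n (minIdx a b u + r s) (minIdx a b v + s) (Matrix.single p q 1) =
      if (u = ((blockEquiv a b).symm p).1 ∧ v = ((blockEquiv a b).symm q).1) ∧
        (((blockEquiv a b).symm p).2 : ℕ) = r ((blockEquiv a b).symm q).2 then 1 else 0 := by
  have hs : ∀ s ∈ Finset.range (compSize a b i),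
      entry n (minIdx a b u + r s) (minIdx a b v + s) (Matrix.single p q 1) =
      if (u = ((blockEquiv a b).symm p).1 ∧ r s = ((blockEquiv a b).symm p).2) ∧
        (v = ((blockEquiv a b).symm q).1 ∧ s = ((blockEquiv a b).symm q).2) then
        1 else 0 := by
    intro s hs
    rw [Finset.mem_range] at hs
    rw [entry_single]
    exact if_congr (and_congr (minIdx_add_eq_iff (by rw [hu]; exact hr s hs) p)
      (minIdx_add_eq_iff (by rw [hv]; exact hs) q)) rfl rfl
  rw [Finset.sum_congr rfl hs]
  by_cases h : v = ((blockEquiv a b).symm q).1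
  · have l2 : (((blockEquiv a b).symm q).2 : ℕ) < compSize a b i :=
      lt_of_lt_of_eq ((blockEquiv a b).symm q).2.2 (by rw [← h, hv])
    rw [Finset.sum_eq_single (((blockEquiv a b).symm q).2 : ℕ)]
    · refine if_congr ?_ rfl rfl
      constructor
      · rintro ⟨⟨h1, h2⟩, h3, -⟩
        exact ⟨⟨h1, h3⟩, h2.symm⟩
      · rintro ⟨⟨h1, h3⟩, h2⟩
        exact ⟨⟨h1, h2.symm⟩, h3, rfl⟩
    · intro t _ ht
      exact if_neg fun h => ht h.2.2
    · intro h
      exact absurd (Finset.mem_range.2 l2) h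
  · rw [if_neg fun h' => h h'.1.2]
    exact Finset.sum_eq_zero fun s _ => if_neg fun h' => h h'.2.1

/-- The coefficients of the sum of transversals in all the peak blocks. -/
theorem sum_peak_single (hE : ∀ u v, OrientedEdge a b u v → vertexComp a b u = vertexComp a b v)
    (r : Fin (numComp a b) → ℕ → ℕ)
    (hr : ∀ i, ∀ s < compSize a b i, r i s < compSize a b i) (p q : Fin n) :
    ∑ i, ∑ e ∈ peakSet a b i, ∑ s ∈ Finset.range (compSize a b i),
      entry n (minIdx a b e.1 + r i s) (minIdx a b e.2 + s) (Matrix.single p q 1) =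
      if OrientedEdge a b ((blockEquiv a b).symm p).1 ((blockEquiv a b).symm q).1 ∧
        (((blockEquiv a b).symm p).2 : ℕ) =
          r (vertexComp a b ((blockEquiv a b).symm p).1) ((blockEquiv a b).symm q).2
      then 1 else 0 := by
  have h1 : ∀ i, ∀ e ∈ peakSet a b i, (vertexComp a b e.1 = i ∧ vertexComp a b e.2 = i) ∧
      OrientedEdge a b e.1 e.2 := by
    intro i e he
    simpa [peakSet, onPath_iff, and_assoc] using he
  rw [Finset.sum_congr rfl fun i _ => Finset.sum_congr rfl fun e he =>
    sum_entry_single (h1 i e he).1.1 (h1 i e he).1.2 (r i) (hr i) p q,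
    Finset.sum_eq_single (vertexComp a b ((blockEquiv a b).symm p).1)]
  · by_cases h : OrientedEdge a b ((blockEquiv a b).symm p).1 ((blockEquiv a b).symm q).1
    · rw [Finset.sum_eq_single (((blockEquiv a b).symm p).1, ((blockEquiv a b).symm q).1)]
      · exact if_congr (by simp [h]) rfl rfl
      · intro e _ he
        exact if_neg fun h' => he (Prod.ext h'.1.1 h'.1.2)
      · intro h'
        exact absurd (by simp [peakSet, onPath_iff, h, hE _ _ h]) h'
    · rw [if_neg fun h' => h h'.1]
      refine Finset.sum_eq_zero fun e he => if_neg fun h' => h ?_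
      rw [← h'.1.1, ← h'.1.2]
      exact (h1 _ e he).2
  · intro i _ hi
    refine Finset.sum_eq_zero fun e he => if_neg fun h => hi ?_
    rw [← h.1.1, (h1 i e he).1.1]
  · simp

theorem coeff_rotate {c : ℕ} (F : Module.Dual ℂ (Matrix (Fin c) (Fin c) ℂ)) {s t : ℕ}
    (hs : s < c) (ht : t < c) : coeff (rotate F) s t = coeff F (c - 1 - s) (c - 1 - t) := by
  rw [coeff, dif_pos ⟨hs, ht⟩, coeff, dif_pos ⟨by omega, by omega⟩, rotate]
  simp only [LinearMap.sum_apply, LinearMap.smul_apply, Matrix.entryLinearMap_apply,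
    Matrix.single_apply, smul_eq_mul, mul_ite, mul_one, mul_zero]
  rw [Finset.sum_eq_single (Fin.rev ⟨s, hs⟩), Finset.sum_eq_single (Fin.rev ⟨t, ht⟩),
    if_pos (by simp)]
  · congr 2 <;> ext <;> simp [Fin.rev] <;> omega
  · intro y _ hy
    refine if_neg fun h => hy ?_
    rw [h.2, Fin.rev_rev]
  · simp
  · intro x _ hx
    refine Finset.sum_eq_zero fun y _ => if_neg fun h => hx ?_
    rw [h.1, Fin.rev_rev]
  · simp

end

/-! ### Dimensions of the two kernels -/

section

variable {n : ℕ} {a b : Composition n}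

/-- The chosen vertices witness that no component is empty. -/
theorem pathSystem_compMeander {v₀ : Fin (numComp a b) → CMVertex a b}
    (hv₀ : ∀ i, OnPath a b i (v₀ i)) :
    PathSystem (fun u v : CMVertex a b => Supp (compMeander a b).top (compMeander a b).bot u v)
      (OrientedEdge a b) (vertexComp a b) :=
  (expands_compMeander a b).path.pathSystem (vertexComp a b) (fun _ => rfl)
    (fun i => ⟨v₀ i, onPath_iff.1 (hv₀ i)⟩) (fun _ _ => Iff.rfl)

/-- A step along an edge changes the height by one, so heights measure the parity of walks. -/
theorem even_walk_length {d : CMVertex a b → ℤ}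
    (hd : ∀ u v, OrientedEdge a b u v → d u = d v + 1) {u v : CMVertex a b}
    (w : (cmGraph a b).Walk u v) : Even (w.length : ℤ) ↔ Even (d u - d v) := by
  induction w with
  | nil => simp
  | @cons x y z hxy w ih =>
    rw [SimpleGraph.Walk.length_cons, Nat.cast_add, Nat.cast_one]
    rw [cmGraph, SimpleGraph.fromRel_adj] at hxy
    rcases hxy.2 with h | h
    · have := hd _ _ h
      rw [show d x - d z = d y - d z + 1 by omega, Int.even_add_one, Int.even_add_one, ih]
    · have := hd _ _ h
      rw [show d y - d z = d x - d z + 1 by omega, Int.even_add_one] at ih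
      rw [Int.even_add_one, ih, not_not]

/-- The two ends of an edge have distances of different parity from the chosen vertex of their
component. As vertices of the same component are connected, the distances are lengths of walks. -/
theorem odd_dist_iff {v₀ : Fin (numComp a b) → CMVertex a b}
    (hv₀ : ∀ i, OnPath a b i (v₀ i)) {u v : CMVertex a b} (huv : OrientedEdge a b u v) :
    Odd ((cmGraph a b).dist (v₀ (vertexComp a b u)) u) ↔
      ¬ Odd ((cmGraph a b).dist (v₀ (vertexComp a b v)) v) := by
  have hP := pathSystem_compMeander hv₀
  obtain ⟨d, hd⟩ := hP.graded
  -- Being reachable from `u` is constant along edges, hence on components.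
  have hreach : ∀ u v, vertexComp a b u = vertexComp a b v → (cmGraph a b).Reachable u v := by
    classical
    intro u v huv
    have := hP.connected (fun w => if (cmGraph a b).Reachable u w then 1 else 0)
      (fun x y hxy => ?_) u v huv
    · rw [if_pos (SimpleGraph.Reachable.refl u)] at this
      by_contra h
      rw [if_neg h] at this
      exact one_ne_zero this
    · have hadj : (cmGraph a b).Adj x y := by
        rw [cmGraph, SimpleGraph.fromRel_adj]
        refine ⟨?_, Or.inl hxy⟩
        rintro rfl
        have := hd _ _ hxy
        omega
      exact if_congr ⟨fun h => h.trans hadj.reachable, fun h => h.trans hadj.symm.reachable⟩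
        rfl rfl
  have hdist : ∀ u v, vertexComp a b u = vertexComp a b v →
      (Odd ((cmGraph a b).dist u v) ↔ ¬ Even (d u - d v)) := by
    intro u v h
    obtain ⟨w, hw⟩ := (hreach u v h).exists_walk_length_eq_dist
    rw [← hw, ← even_walk_length hd w, Int.even_coe_nat, Nat.not_even_iff_odd]
  have hv : ∀ v, vertexComp a b (v₀ (vertexComp a b v)) = vertexComp a b v :=
    fun v => onPath_iff.1 (hv₀ _)
  rw [hdist _ _ (hv u), hdist _ _ (hv v), hP.edge_lab u v huv]
  have := hd u v huv
  rw [show d (v₀ (vertexComp a b v)) - d v = d (v₀ (vertexComp a b v)) - d u + 1 by omega,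
    Int.even_add_one, not_not]

theorem mem_seaweed_iff {X : Matrix (Fin n) (Fin n) ℂ} : X ∈ seaweed a b ↔ ∀ p q : Fin n,
    ¬ Supp (compMeander a b).top (compMeander a b).bot ((blockEquiv a b).symm p).1
      ((blockEquiv a b).symm q).1 → X p q = 0 := by
  simp only [mem_seaweed, supp_blockEquiv_symm]

theorem dimKer_Fbar (F : ∀ i : Fin (numComp a b),
      Module.Dual ℂ (Matrix (Fin (compSize a b i)) (Fin (compSize a b i)) ℂ))
    {v₀ : Fin (numComp a b) → CMVertex a b} (hv₀ : ∀ i, OnPath a b i (v₀ i)) :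
    dimKer (Fbar a b F) = ∑ i, dimKer (F i) := by
  have hP := pathSystem_compMeander hv₀
  refine dimKer_eq_sum hP (blockEquiv a b).symm (seaweed a b) (fun X => mem_seaweed_iff) F _ ?_
  intro p q
  simp only [LinearMap.sum_apply, LinearMap.add_apply]
  rw [Finset.sum_add_distrib, sum_shift_single (fun i _ => F i) p q,
    sum_peak_single hP.edge_lab (fun _ s => s) (fun _ _ h => h) p q]

/-- The vertex and the offset of an index, where the offsets are counted from the right in the
intervals of the vertices at odd distance from the chosen ones. -/
noncomputable def flippedEquiv (a b : Composition n) (v₀ : Fin (numComp a b) → CMVertex a b) :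
    Fin n ≃ Σ v : CMVertex a b, Fin (compSize a b (vertexComp a b v)) :=
  (blockEquiv a b).symm.trans (Equiv.sigmaCongrRight fun v =>
    if Odd ((cmGraph a b).dist (v₀ (vertexComp a b v)) v) then Fin.revPerm else Equiv.refl _)

theorem flippedEquiv_snd (v₀ : Fin (numComp a b) → CMVertex a b) (p : Fin n) :
    ((flippedEquiv a b v₀ p).2 : ℕ) =
      if Odd ((cmGraph a b).dist (v₀ (vertexComp a b ((blockEquiv a b).symm p).1))
          ((blockEquiv a b).symm p).1) then
        compSize a b (vertexComp a b ((blockEquiv a b).symm p).1) - 1 - ((blockEquiv a b).symm p).2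
      else ((blockEquiv a b).symm p).2 := by
  change ((((if Odd ((cmGraph a b).dist (v₀ (vertexComp a b ((blockEquiv a b).symm p).1))
      ((blockEquiv a b).symm p).1) then Fin.revPerm else Equiv.refl _ : Equiv.Perm (Fin _))
        ((blockEquiv a b).symm p).2) : Fin _) : ℕ) = _
  split_ifs
  · simp only [Fin.revPerm_apply, Fin.val_rev]
    omega
  · rfl

theorem dimKer_FbarA (F : ∀ i : Fin (numComp a b),
      Module.Dual ℂ (Matrix (Fin (compSize a b i)) (Fin (compSize a b i)) ℂ))
    {v₀ : Fin (numComp a b) → CMVertex a b} (hv₀ : ∀ i, OnPath a b i (v₀ i)) :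
    dimKer (FbarA a b v₀ F) = ∑ i, dimKer (F i) := by
  have hP := pathSystem_compMeander hv₀
  have hfst : ∀ p, (flippedEquiv a b v₀ p).1 = ((blockEquiv a b).symm p).1 := fun p => rfl
  refine dimKer_eq_sum hP (flippedEquiv a b v₀) (seaweed a b)
    (fun X => mem_seaweed_iff) F _ ?_
  intro p q
  -- The two kinds of core blocks in one sum.
  have hcore : ∀ i, (∑ v ∈ oddVertices a b i (v₀ i), shift n (rotate (F i)) (minIdx a b v)) +
      (∑ v ∈ evenVertices a b i (v₀ i), shift n (F i) (minIdx a b v)) =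
      ∑ v ∈ pathVertices a b i,
        shift n (if Odd ((cmGraph a b).dist (v₀ i) v) then rotate (F i) else F i)
          (minIdx a b v) := by
    intro i
    rw [← Finset.sum_filter_add_sum_filter_not (pathVertices a b i)
      (fun v => Odd ((cmGraph a b).dist (v₀ i) v))]
    congr 1
    · refine Finset.sum_congr rfl fun v hv => ?_
      rw [if_pos (Finset.mem_filter.1 hv).2]
    · simp only [evenVertices, ← Nat.not_odd_iff_even]
      refine Finset.sum_congr rfl fun v hv => ?_
      rw [if_neg (Finset.mem_filter.1 hv).2]
  have hpeak : ∀ i, (∑ e ∈ peakSet a b i, ∑ s ∈ Finset.range (compSize a b i),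
        entry n (minIdx a b e.1 + compSize a b i - 1 - s) (minIdx a b e.2 + s)) =
      ∑ e ∈ peakSet a b i, ∑ s ∈ Finset.range (compSize a b i),
        entry n (minIdx a b e.1 + (compSize a b i - 1 - s)) (minIdx a b e.2 + s) := by
    intro i
    refine Finset.sum_congr rfl fun e _ => Finset.sum_congr rfl fun s hs => ?_
    rw [Finset.mem_range] at hs
    congr 1
    omega
  simp only [hcore, hpeak]
  simp only [LinearMap.sum_apply, LinearMap.add_apply]
  rw [Finset.sum_add_distrib,
    sum_shift_single (fun i v => if Odd ((cmGraph a b).dist (v₀ i) v) then rotate (F i) else F i)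
      p q,
    sum_peak_single hP.edge_lab (fun i s => compSize a b i - 1 - s) (fun _ _ h => by omega) p q]
  -- Stated for free vertices and offsets, as the type of an offset depends on its vertex.
  have key : ∀ (u v : CMVertex a b) (s t : ℕ), s < compSize a b (vertexComp a b u) →
      t < compSize a b (vertexComp a b v) →
      (if u = v then coeff (if Odd ((cmGraph a b).dist (v₀ (vertexComp a b u)) u)
          then rotate (F (vertexComp a b u)) else F (vertexComp a b u)) s t else 0) +
        (if OrientedEdge a b u v ∧ s = compSize a b (vertexComp a b u) - 1 - t
          then (1 : ℂ) else 0) =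
      (if u = v then coeff (F (vertexComp a b u))
          (if Odd ((cmGraph a b).dist (v₀ (vertexComp a b u)) u)
            then compSize a b (vertexComp a b u) - 1 - s else s)
          (if Odd ((cmGraph a b).dist (v₀ (vertexComp a b v)) v)
            then compSize a b (vertexComp a b v) - 1 - t else t) else 0) +
        (if OrientedEdge a b u v ∧
            (if Odd ((cmGraph a b).dist (v₀ (vertexComp a b u)) u)
              then compSize a b (vertexComp a b u) - 1 - s else s) =
            (if Odd ((cmGraph a b).dist (v₀ (vertexComp a b v)) v)
              then compSize a b (vertexComp a b v) - 1 - t else t)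
          then (1 : ℂ) else 0) := by
    intro u v s t hx hy
    congr 1
    · refine if_ctx_congr Iff.rfl (fun huv => ?_) (fun _ => rfl)
      subst huv
      split_ifs
      · exact coeff_rotate _ hx hy
      · rfl
    · refine if_congr (and_congr_right fun huv => ?_) rfl rfl
      have h1 := odd_dist_iff hv₀ huv
      have h2 := hP.edge_lab u v huv
      rw [h2] at hx h1 ⊢
      split_ifs <;> first | omega | (exfalso; tauto)
  rw [flippedEquiv_snd, flippedEquiv_snd]
  exact key _ _ _ _ ((blockEquiv a b).symm p).2.2 ((blockEquiv a b).symm q).2.2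

end

end Seaweed

theorem mainTheorem1 {n : ℕ} (a b : Composition n)
    (F : ∀ i : Fin (Seaweed.numComp a b),
      Module.Dual ℂ (Matrix (Fin (Seaweed.compSize a b i)) (Fin (Seaweed.compSize a b i)) ℂ))
    (v₀ : Fin (Seaweed.numComp a b) → Seaweed.CMVertex a b)
    (hv₀ : ∀ i, Seaweed.OnPath a b i (v₀ i)) :
    Seaweed.dimKer (Seaweed.FbarA a b v₀ F) = Seaweed.dimKer (Seaweed.Fbar a b F) ∧
      Seaweed.dimKer (Seaweed.Fbar a b F) = ∑ i, Seaweed.dimKer (F i) := by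
  rw [Seaweed.dimKer_FbarA F hv₀, Seaweed.dimKer_Fbar F hv₀]
  exact ⟨rfl, rfl⟩
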